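/- Let $k$ be an algebraically closed field and let $C$ be a finite-dimensional $k$-algebra of global dimension at most $2$. All modules are finitely generated right modules; $D=\operatorname{Hom}_k(-,k)$ is the standard duality, $\tau=D\operatorname{Tr}$ and $\tau^{-1}=\operatorname{Tr}D$ are the Auslander–Reiten translations, and $\Omega^{-1}M$ is the cokernel of an injective envelope of $M$. Let $E=\operatorname{Ext}^2_C(DC,C)$ with its natural $C$-$C$-bimodule structure, and let $B=C\ltimes E$ be the relation extension of $C$, i.e. $B=C\oplus E$ with multiplication $(c,e)(c',e')=(cc',ce'+ec')$. Every $C$-module $M$ is regarded as a $B$-module through $m\cdot(c,e)=mc$. A $B$-module $M$ is called $\tau_B$-rigid if $\operatorname{Hom}_B(M,\tau_BM)=0$. Let $P$ be a projective $C$-module and let $\overline{P}$ be a projective cover of $\tau_C^{-1}\Omega_C^{-1}P$ in the category of finitely generated right $C$-modules. Then $P$ is $\tau_B$-rigid if and only if $\operatorname{Hom}_C(\overline{P},P)=0$. -/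

import Mathlib

/-!
Conventions.  `k` is a field and `Λ`, `C` are `k`-algebras.  A left `Λ`-module is a `Module Λ M`;
a right `Λ`-module is a `Module Λᵐᵒᵖ M`, the right action being `m · c = MulOpposite.op c • m`.
-/

universe u

open CategoryTheory MulOpposite

namespace TauRigid

/-! ### Projective covers, injective envelopes, minimal projective presentations -/

section Covers

variable (R : Type u) [Ring R]

/-- `π : P → M` is a projective cover in the category of finitely generated `R`-modules: `P` is
finitely generated projective, `π` is surjective, and `ker π` is superfluous in `P`. -/
structure IsProjectiveCover {P M : Type u} [AddCommGroup P] [Module R P]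
    [AddCommGroup M] [Module R M] (π : P →ₗ[R] M) : Prop where
  finite : Module.Finite R P
  projective : Module.Projective R P
  surjective : Function.Surjective π
  superfluous : ∀ N : Submodule R P, N ⊔ LinearMap.ker π = ⊤ → N = ⊤

/-- `ι : M → I` is an injective envelope in the category of finitely generated `R`-modules: `I` is
finitely generated and injective, `ι` is injective, and its image is essential in `I`. -/
structure IsInjectiveEnvelope {M I : Type u} [AddCommGroup M] [Module R M]
    [AddCommGroup I] [Module R I] (ι : M →ₗ[R] I) : Prop where
  finite : Module.Finite R I
  isInjective : Module.Injective R I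
  injective : Function.Injective ι
  essential : ∀ N : Submodule R I, N ⊓ LinearMap.range ι = ⊥ → N = ⊥

/-- `P₁ --d₁--> P₀ --d₀--> M → 0` is a minimal projective presentation: it is exact, `d₀` is a
projective cover of `M` and `d₁` is a projective cover of `ker d₀ = im d₁`. -/
structure IsMinimalProjectivePresentation {P₁ P₀ M : Type u} [AddCommGroup P₁] [Module R P₁]
    [AddCommGroup P₀] [Module R P₀] [AddCommGroup M] [Module R M]
    (d₁ : P₁ →ₗ[R] P₀) (d₀ : P₀ →ₗ[R] M) : Prop where
  exact : LinearMap.range d₁ = LinearMap.ker d₀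
  cover₀ : IsProjectiveCover R d₀
  cover₁ : IsProjectiveCover R d₁.rangeRestrict

/-- The right `C`-module `W` is (isomorphic to) the first cosyzygy `Ω⁻¹ M` of the right
`C`-module `M`: the cokernel of an injective envelope of `M`. -/
def IsCosyzygy (C : Type u) [Ring C] (M W : Type u) [AddCommGroup M] [Module Cᵐᵒᵖ M]
    [AddCommGroup W] [Module Cᵐᵒᵖ W] : Prop :=
  ∃ (I : Type u) (_ : AddCommGroup I) (_ : Module Cᵐᵒᵖ I) (ι : M →ₗ[Cᵐᵒᵖ] I),
    IsInjectiveEnvelope Cᵐᵒᵖ ι ∧ Nonempty (W ≃ₗ[Cᵐᵒᵖ] (I ⧸ LinearMap.range ι))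

end Covers

/-! ### The standard duality `D = Hom_k(-, k)` -/

section Duality

/-- The standard dual `D M = Hom_k(M, k)`. -/
def StdDual (k M : Type u) [Field k] [AddCommGroup M] [Module k M] : Type u :=
  M →ₗ[k] k

variable {k Λ M : Type u} [Field k] [Ring Λ] [Algebra k Λ] [AddCommGroup M] [Module k M]

instance : AddCommGroup (StdDual k M) := inferInstanceAs (AddCommGroup (M →ₗ[k] k))

instance : FunLike (StdDual k M) M k := inferInstanceAs (FunLike (M →ₗ[k] k) M k)

/-- If `M` is a right `Λ`-module, then `D M` is a left one: `(c · f)(m) = f(m · c)`. -/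
instance [Module Λᵐᵒᵖ M] [IsScalarTower k Λᵐᵒᵖ M] : Module Λ (StdDual k M) where
  smul c f := LinearMap.comp (M₂ := M) (M₃ := k) f (DistribSMul.toLinearMap k M (op c))
  one_smul f := LinearMap.ext fun m => congrArg (f : M → k) (one_smul Λᵐᵒᵖ m)
  mul_smul c c' f := LinearMap.ext fun m => congrArg (f : M → k) (mul_smul (op c') (op c) m)
  smul_zero _ := rfl
  smul_add _ _ _ := rfl
  add_smul c c' f := LinearMap.ext fun m =>
    (congrArg (f : M → k) (add_smul (op c) (op c') m)).trans
      (map_add (show M →ₗ[k] k from f) _ _)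
  zero_smul f := LinearMap.ext fun m =>
    (congrArg (f : M → k) (zero_smul Λᵐᵒᵖ m)).trans (map_zero (show M →ₗ[k] k from f))

/-- If `M` is a left `Λ`-module, then `D M` is a right one: `(f · c)(m) = f(c · m)`. -/
instance [Module Λ M] [IsScalarTower k Λ M] : Module Λᵐᵒᵖ (StdDual k M) where
  smul c f := LinearMap.comp (M₂ := M) (M₃ := k) f (DistribSMul.toLinearMap k M (unop c))
  one_smul f := LinearMap.ext fun m => congrArg (f : M → k) (one_smul Λ m)
  mul_smul c c' f := LinearMap.ext fun m => congrArg (f : M → k) (mul_smul (unop c') (unop c) m)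
  smul_zero _ := rfl
  smul_add _ _ _ := rfl
  add_smul c c' f := LinearMap.ext fun m =>
    (congrArg (f : M → k) (add_smul (unop c) (unop c') m)).trans
      (map_add (show M →ₗ[k] k from f) _ _)
  zero_smul f := LinearMap.ext fun m =>
    (congrArg (f : M → k) (zero_smul Λ m)).trans (map_zero (show M →ₗ[k] k from f))

theorem StdDual.smul_apply [Module Λᵐᵒᵖ M] [IsScalarTower k Λᵐᵒᵖ M]
    (c : Λ) (f : StdDual k M) (m : M) : (c • f) m = f (op c • m) := rfl

theorem StdDual.op_smul_apply [Module Λ M] [IsScalarTower k Λ M]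
    (c : Λ) (f : StdDual k M) (m : M) : (op c • f) m = f (c • m) := rfl

end Duality

/-! ### Transpose and Auslander-Reiten translations -/

section Translations

/-- For a map `d : P₁ → P₀` of right `Λ`-modules, the left `Λ`-module
`coker (Hom_Λ(d, Λ) : Hom_Λ(P₀, Λ) → Hom_Λ(P₁, Λ))`. If `d` is the first map of a minimal
projective presentation of `M`, this is the transpose `Tr M`. -/
abbrev TrRight (Λ : Type u) [Ring Λ] {P₁ P₀ : Type u} [AddCommGroup P₁] [Module Λᵐᵒᵖ P₁]
    [AddCommGroup P₀] [Module Λᵐᵒᵖ P₀] (d : P₁ →ₗ[Λᵐᵒᵖ] P₀) : Type u :=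
  (P₁ →ₗ[Λᵐᵒᵖ] Λ) ⧸ LinearMap.range (LinearMap.lcomp Λ Λ d)

/-- For a map `d : Q₁ → Q₀` of left `Λ`-modules, the right `Λ`-module
`coker (Hom_Λ(d, Λ) : Hom_Λ(Q₀, Λ) → Hom_Λ(Q₁, Λ))`. -/
abbrev TrLeft (Λ : Type u) [Ring Λ] {Q₁ Q₀ : Type u} [AddCommGroup Q₁] [Module Λ Q₁]
    [AddCommGroup Q₀] [Module Λ Q₀] (d : Q₁ →ₗ[Λ] Q₀) : Type u :=
  (Q₁ →ₗ[Λ] Λ) ⧸ LinearMap.range (LinearMap.lcomp Λᵐᵒᵖ Λ d)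

variable (k Λ : Type u) [Field k] [Ring Λ] [Algebra k Λ]

/-- The right `Λ`-module `N` is (isomorphic to) the Auslander-Reiten translate `τ M = D Tr M` of
the right `Λ`-module `M`. -/
def IsTau (M N : Type u) [AddCommGroup M] [Module Λᵐᵒᵖ M] [AddCommGroup N] [Module Λᵐᵒᵖ N] :
    Prop :=
  ∃ (P₁ P₀ : Type u) (_ : AddCommGroup P₁) (_ : Module Λᵐᵒᵖ P₁) (_ : AddCommGroup P₀)
    (_ : Module Λᵐᵒᵖ P₀) (d₁ : P₁ →ₗ[Λᵐᵒᵖ] P₀) (d₀ : P₀ →ₗ[Λᵐᵒᵖ] M),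
    IsMinimalProjectivePresentation Λᵐᵒᵖ d₁ d₀ ∧
      Nonempty (N ≃ₗ[Λᵐᵒᵖ] StdDual k (TrRight Λ d₁))

/-- The right `Λ`-module `N` is (isomorphic to) the inverse Auslander-Reiten translate
`τ⁻¹ M = Tr D M` of the right `Λ`-module `M`. -/
def IsTauInv (M N : Type u) [AddCommGroup M] [Module k M] [Module Λᵐᵒᵖ M]
    [IsScalarTower k Λᵐᵒᵖ M] [AddCommGroup N] [Module Λᵐᵒᵖ N] : Prop :=
  ∃ (Q₁ Q₀ : Type u) (_ : AddCommGroup Q₁) (_ : Module Λ Q₁) (_ : AddCommGroup Q₀)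
    (_ : Module Λ Q₀) (d₁ : Q₁ →ₗ[Λ] Q₀) (d₀ : Q₀ →ₗ[Λ] StdDual k M),
    IsMinimalProjectivePresentation Λ d₁ d₀ ∧ Nonempty (N ≃ₗ[Λᵐᵒᵖ] TrLeft Λ d₁)

/-- `M` is `τ_Λ`-rigid: `Hom_Λ(M, τ M) = 0`. (`τ M` is unique up to isomorphism.) -/
def IsTauRigid (M : Type u) [AddCommGroup M] [Module Λᵐᵒᵖ M] : Prop :=
  ∃ (N : Type u) (_ : AddCommGroup N) (_ : Module Λᵐᵒᵖ N),
    IsTau k Λ M N ∧ ∀ f : M →ₗ[Λᵐᵒᵖ] N, f = 0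

end Translations

/-! ### Global dimension -/

/-- The category of finitely generated right `C`-modules has global dimension at most `n`. -/
def GlobalDimensionLE (C : Type u) [Ring C] (n : ℕ) : Prop :=
  ∀ (M : Type u) [AddCommGroup M] [Module Cᵐᵒᵖ M] [Module.Finite Cᵐᵒᵖ M],
    HasProjectiveDimensionLE (ModuleCat.of Cᵐᵒᵖ M) n

/-! ### The relation extension -/

section RelationExtension

variable (k C : Type u) [Field k] [Ring C] [Algebra k C]

variable {C} in
/-- Left multiplication by `c` on `C`, as an endomorphism of the right module `C`. -/
def leftMul (c : C) : ModuleCat.of Cᵐᵒᵖ C ⟶ ModuleCat.of Cᵐᵒᵖ C :=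
  ModuleCat.ofHom
    { toFun := fun x => c * x
      map_add' := mul_add c
      map_smul' := fun r x => (mul_assoc c x (unop r)).symm }

variable {C} in
/-- The left action of `c` on `DC`, as an endomorphism of the right module `DC`. -/
def dualLeftMul (c : C) :
    ModuleCat.of Cᵐᵒᵖ (StdDual k C) ⟶ ModuleCat.of Cᵐᵒᵖ (StdDual k C) :=
  ModuleCat.ofHom
    { toFun := fun f => c • f
      map_add' := smul_add c
      map_smul' := fun r f => LinearMap.ext fun x =>
        congrArg (f : C → k) (mul_assoc (unop r) x c).symm }

/-- The group `Ext²_C(DC, C)`, computed in the category of right `C`-modules. -/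
abbrev ExtDual : Type u :=
  Abelian.Ext.{u} (ModuleCat.of Cᵐᵒᵖ (StdDual k C)) (ModuleCat.of Cᵐᵒᵖ C) 2

/-- The action of `C` on `Ext²_C(DC, C)` induced by left multiplication on the second argument. -/
noncomputable def extLeftAction : C →+* AddMonoid.End (ExtDual k C) where
  toFun c :=
    { toFun := fun e => e.comp (Abelian.Ext.mk₀ (leftMul c)) (add_zero 2)
      map_zero' := Abelian.Ext.zero_comp _ _ _ _ _
      map_add' := fun e e' => Abelian.Ext.add_comp _ _ _ _ }
  map_one' := by
    have h : leftMul (1 : C) = 𝟙 _ := ModuleCat.hom_ext (LinearMap.ext fun x => one_mul x)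
    ext e : 1
    change e.comp (Abelian.Ext.mk₀ (leftMul (1 : C))) (add_zero 2) = e
    rw [h, Abelian.Ext.comp_mk₀_id]
  map_mul' c c' := by
    have h : leftMul (c * c') = leftMul c' ≫ leftMul c :=
      ModuleCat.hom_ext (LinearMap.ext fun x => mul_assoc c c' x)
    ext e : 1
    change e.comp (Abelian.Ext.mk₀ (leftMul (c * c'))) (add_zero 2) =
      (e.comp (Abelian.Ext.mk₀ (leftMul c')) (add_zero 2)).comp
        (Abelian.Ext.mk₀ (leftMul c)) (add_zero 2)
    rw [h, ← Abelian.Ext.mk₀_comp_mk₀, Abelian.Ext.comp_assoc_of_third_deg_zero]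
  map_zero' := by
    have h : leftMul (0 : C) = 0 := ModuleCat.hom_ext (LinearMap.ext fun x => zero_mul x)
    ext e : 1
    change e.comp (Abelian.Ext.mk₀ (leftMul (0 : C))) (add_zero 2) = 0
    rw [h, Abelian.Ext.mk₀_zero, Abelian.Ext.comp_zero]
  map_add' c c' := by
    have h : leftMul (c + c') = leftMul c + leftMul c' :=
      ModuleCat.hom_ext (LinearMap.ext fun x => add_mul c c' x)
    ext e : 1
    change e.comp (Abelian.Ext.mk₀ (leftMul (c + c'))) (add_zero 2) =
      e.comp (Abelian.Ext.mk₀ (leftMul c)) (add_zero 2) +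
        e.comp (Abelian.Ext.mk₀ (leftMul c')) (add_zero 2)
    rw [h, Abelian.Ext.mk₀_add, Abelian.Ext.comp_add]

/-- The action of `Cᵐᵒᵖ` on `Ext²_C(DC, C)` induced by the left action on the first argument. -/
noncomputable def extRightAction : Cᵐᵒᵖ →+* AddMonoid.End (ExtDual k C) where
  toFun c :=
    { toFun := fun e => (Abelian.Ext.mk₀ (dualLeftMul k (unop c))).comp e (zero_add 2)
      map_zero' := Abelian.Ext.comp_zero _ _ _ _ _
      map_add' := fun e e' => Abelian.Ext.comp_add _ _ _ _ }
  map_one' := by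
    have h : dualLeftMul k (1 : C) = 𝟙 _ :=
      ModuleCat.hom_ext (LinearMap.ext fun f => one_smul C f)
    ext e : 1
    change (Abelian.Ext.mk₀ (dualLeftMul k (1 : C))).comp e (zero_add 2) = e
    rw [h, Abelian.Ext.mk₀_id_comp]
  map_mul' c c' := by
    have h : dualLeftMul k (unop (c * c')) = dualLeftMul k (unop c) ≫ dualLeftMul k (unop c') :=
      ModuleCat.hom_ext (LinearMap.ext fun f => mul_smul (unop c') (unop c) f)
    ext e : 1
    change (Abelian.Ext.mk₀ (dualLeftMul k (unop (c * c')))).comp e (zero_add 2) =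
      (Abelian.Ext.mk₀ (dualLeftMul k (unop c))).comp
        ((Abelian.Ext.mk₀ (dualLeftMul k (unop c'))).comp e (zero_add 2)) (zero_add 2)
    rw [h, Abelian.Ext.mk₀_comp_mk₀_assoc]
  map_zero' := by
    have h : dualLeftMul k (0 : C) = 0 :=
      ModuleCat.hom_ext (LinearMap.ext fun f => zero_smul C f)
    ext e : 1
    change (Abelian.Ext.mk₀ (dualLeftMul k (0 : C))).comp e (zero_add 2) = 0
    rw [h, Abelian.Ext.mk₀_zero, Abelian.Ext.zero_comp]
  map_add' c c' := by
    have h : dualLeftMul k (unop (c + c')) =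
        dualLeftMul k (unop c) + dualLeftMul k (unop c') :=
      ModuleCat.hom_ext (LinearMap.ext fun f => add_smul (unop c) (unop c') f)
    ext e : 1
    change (Abelian.Ext.mk₀ (dualLeftMul k (unop (c + c')))).comp e (zero_add 2) =
      (Abelian.Ext.mk₀ (dualLeftMul k (unop c))).comp e (zero_add 2) +
        (Abelian.Ext.mk₀ (dualLeftMul k (unop c'))).comp e (zero_add 2)
    rw [h, Abelian.Ext.mk₀_add, Abelian.Ext.add_comp]

/-- The `C`-`C`-bimodule `E = Ext²_C(DC, C)`. -/
def RelationBimodule : Type u := ExtDual k C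

noncomputable instance : AddCommGroup (RelationBimodule k C) :=
  inferInstanceAs (AddCommGroup (ExtDual k C))

noncomputable instance : Module C (RelationBimodule k C) :=
  Module.compHom (ExtDual k C) (extLeftAction k C)

noncomputable instance : Module Cᵐᵒᵖ (RelationBimodule k C) :=
  Module.compHom (ExtDual k C) (extRightAction k C)

/-- The `k`-vector space structure on `E`, through the left action of `C`. -/
noncomputable instance : Module k (RelationBimodule k C) :=
  Module.compHom (RelationBimodule k C) (algebraMap k C)

theorem RelationBimodule.smul_def (c : C) (e : ExtDual k C) :
    (c • (show RelationBimodule k C from e) : RelationBimodule k C) =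
      e.comp (Abelian.Ext.mk₀ (leftMul c)) (add_zero 2) := rfl

theorem RelationBimodule.op_smul_def (c : C) (e : ExtDual k C) :
    (op c • (show RelationBimodule k C from e) : RelationBimodule k C) =
      (Abelian.Ext.mk₀ (dualLeftMul k c)).comp e (zero_add 2) := rfl

instance : SMulCommClass C Cᵐᵒᵖ (RelationBimodule k C) where
  smul_comm c c' e := Abelian.Ext.comp_assoc_of_third_deg_zero
    (Abelian.Ext.mk₀ (dualLeftMul k (unop c'))) (show ExtDual k C from e)
    (Abelian.Ext.mk₀ (leftMul c)) (zero_add 2)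

instance : IsScalarTower k C (RelationBimodule k C) where
  smul_assoc a c e := by
    change (a • c) • e = algebraMap k C a • (c • e)
    rw [Algebra.smul_def, mul_smul]

/-- `k` acts centrally on `E`. -/
theorem RelationBimodule.op_algebraMap_smul (a : k) (e : RelationBimodule k C) :
    op (algebraMap k C a) • e = algebraMap k C a • e := by
  obtain ⟨s, hs, hcomm⟩ : ∃ s : (X : ModuleCat.{u} Cᵐᵒᵖ) → (X ⟶ X),
      (∀ (X : ModuleCat.{u} Cᵐᵒᵖ) (x : X), (s X).hom x = op (algebraMap k C a) • x) ∧
      ∀ (X Y : ModuleCat.{u} Cᵐᵒᵖ) (e : Abelian.Ext X Y 2),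
        (Abelian.Ext.mk₀ (s X)).comp e (zero_add 2) =
          e.comp (Abelian.Ext.mk₀ (s Y)) (add_zero 2) :=
    ⟨fun X => a • 𝟙 X, fun X x => rfl, fun X Y e => by
      rw [← Abelian.Ext.smul_eq_comp_mk₀, Abelian.Ext.mk₀_smul, Abelian.Ext.smul_comp,
        Abelian.Ext.mk₀_id_comp]⟩
  have h₀ : ∀ f : StdDual k C, algebraMap k C a • f = op (algebraMap k C a) • f := fun f =>
    DFunLike.ext _ _ fun x => by
      rw [StdDual.smul_apply, StdDual.op_smul_apply, op_smul_eq_mul, smul_eq_mul,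
        Algebra.commutes]
  have h₁ : dualLeftMul k (algebraMap k C a) = s _ :=
    ModuleCat.hom_ext (LinearMap.ext fun f =>
      (h₀ f).trans (hs (ModuleCat.of Cᵐᵒᵖ (StdDual k C)) f).symm)
  have h₂ : leftMul (algebraMap k C a) = s _ :=
    ModuleCat.hom_ext (LinearMap.ext fun x =>
      (Algebra.commutes a (show C from x)).trans (hs (ModuleCat.of Cᵐᵒᵖ C) x).symm)
  have key : ∀ e : ExtDual k C,
      (Abelian.Ext.mk₀ (dualLeftMul k (algebraMap k C a))).comp e (zero_add 2) =
        e.comp (Abelian.Ext.mk₀ (leftMul (algebraMap k C a))) (add_zero 2) := fun e => by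
    rw [h₁, h₂, hcomm]
  exact key e

instance : IsScalarTower k Cᵐᵒᵖ (RelationBimodule k C) where
  smul_assoc a c e := by
    obtain ⟨c, rfl⟩ := op_surjective c
    change op (a • c) • e = algebraMap k C a • (op c • e)
    rw [Algebra.smul_def, ← RelationBimodule.op_algebraMap_smul, Algebra.commutes, op_mul, mul_smul]

/-- The relation extension `B = C ⋉ E`: the trivial extension, with underlying group `C × E` and
`(c, e)(c', e') = (c c', c e' + e c')`. -/
abbrev RelationExtension : Type u := TrivSqZeroExt C (RelationBimodule k C)

/-- A right `C`-module `M`, regarded as a right module over `B = C ⋉ E` through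
`m · (c, e) = m · c`. -/
def ViaB (_k _C M : Type u) : Type u := M

instance (M : Type u) [AddCommGroup M] : AddCommGroup (ViaB k C M) :=
  inferInstanceAs (AddCommGroup M)

noncomputable instance (M : Type u) [AddCommGroup M] [Module Cᵐᵒᵖ M] :
    Module (RelationExtension k C)ᵐᵒᵖ (ViaB k C M) :=
  Module.compHom M
    (RingHom.op (TrivSqZeroExt.fstHom k C (RelationBimodule k C)).toRingHom)

theorem ViaB.op_smul_def (M : Type u) [AddCommGroup M] [Module Cᵐᵒᵖ M]
    (b : RelationExtension k C) (m : M) :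
    (op b • (show ViaB k C M from m) : ViaB k C M) = (op b.fst • m : M) := rfl

end RelationExtension

end TauRigid

/-! Take a minimal projective presentation `P₁ → P₀ → P` over `B`, with maps `d₁` and `d₀`. Over any
algebra, `Hom(M, D Tr M)` is dual to the cokernel of `Hom(P₀, M) → Hom(P₁, M)`, so rigidity says
that every map `P₁ → P` factors through `d₁` (`hom_stdDual_trRight_eq_zero_iff`). Since `E` acts as
zero on `P`, every map `P₀ → P` kills `ker d₀ = im d₁` (`apply_eq_zero_of_mem_ker`), and the
condition becomes `Hom_B(P₁, P) = 0`.

Here `P₁` is the projective cover over `B` of `ker d₀`. As `P` is projective over `C`, this kernel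
is `P ⊗ E = Ext²(DC, P)` (`exists_ker_equiv_extTwo`). With `W = Ω⁻¹P`, dimension shifting gives
`Ext²(DC, P) = Ext¹(DC, W)`. Dualizing a minimal presentation `Q₁ → Q₀ → DW` yields `0 → W → DQ₀ →
DQ₁`. Global dimension two bounds the injective dimension of `W` by one, so the last map is onto
(`stdDualMap_surjective`). Applying `Hom(DC, -)`, with `Hom(DC, DQᵢ) = Hom(Qᵢ, C)`, identifies
`Ext¹(DC, W)` with `Tr D W = τ⁻¹W` (`exists_trLeft_equiv_extTwo`).

Thus `P₁` and the given `C`-module cover both the same module `τ⁻¹Ω⁻¹P`, one over `B` and one over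
`C`. Such covers have nonzero maps to the same `C`-modules (`hom_viaB_eq_zero_iff`). -/

namespace TauRigid

/-! ### Dual bases and maps into `D Tr` -/

section DualBasis

variable {Λ : Type u} [Ring Λ] {M : Type u} [AddCommGroup M] [Module Λᵐᵒᵖ M]

/-- The map `Λ → M`, `x ↦ m · x`, of right modules. -/
def orbitMap (m : M) : Λ →ₗ[Λᵐᵒᵖ] M where
  toFun x := op x • m
  map_add' x y := by rw [MulOpposite.op_add, add_smul]
  map_smul' r x := by
    rw [RingHom.id_apply, ← mul_smul]; rfl

@[simp] theorem orbitMap_apply (m : M) (x : Λ) : orbitMap m x = op x • m := rfl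

theorem exists_dual_basis (Q : Type u) [AddCommGroup Q] [Module Λᵐᵒᵖ Q] [Module.Finite Λᵐᵒᵖ Q]
    [Module.Projective Λᵐᵒᵖ Q] :
    ∃ (n : ℕ) (x : Fin n → Q) (g : Fin n → Q →ₗ[Λᵐᵒᵖ] Λ), ∀ q, ∑ i, op (g i q) • x i = q := by
  obtain ⟨n, f, g, -, -, hfg⟩ := Module.Finite.exists_comp_eq_id_of_projective Λᵐᵒᵖ Q
  refine ⟨n, fun i => f (Pi.single i 1), fun i =>
    { toFun := fun q => unop (g q i)
      map_add' := fun q q' => by simp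
      map_smul' := fun r q => by simp }, fun q => ?_⟩
  have h := LinearMap.congr_fun hfg q
  rw [LinearMap.comp_apply, LinearMap.id_apply] at h
  conv_rhs => rw [← h, pi_eq_sum_univ' (g q), map_sum]
  refine Finset.sum_congr rfl fun i _ => ?_
  rw [map_smul]
  rfl

variable {k : Type u} [Field k] [Algebra k Λ] {P₁ P₀ : Type u} [AddCommGroup P₁]
  [Module Λᵐᵒᵖ P₁] [AddCommGroup P₀] [Module Λᵐᵒᵖ P₀] (d : P₁ →ₗ[Λᵐᵒᵖ] P₀)

/-- This is the duality between `Hom(M, D Tr)` and the cokernel of `Hom(d, M)`, coming from `M ⊗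
Hom(Pᵢ, Λ) ≅ Hom(Pᵢ, M)`. Dual bases replace the tensor product. -/
theorem hom_stdDual_trRight_eq_zero_iff [Module.Finite Λᵐᵒᵖ P₁] [Module.Projective Λᵐᵒᵖ P₁]
    [Module.Finite Λᵐᵒᵖ P₀] [Module.Projective Λᵐᵒᵖ P₀] :
    (∀ F : M →ₗ[Λᵐᵒᵖ] StdDual k (TrRight Λ d), F = 0) ↔
      ∀ f : P₁ →ₗ[Λᵐᵒᵖ] M, ∃ h : P₀ →ₗ[Λᵐᵒᵖ] M, f = h ∘ₗ d := by
  obtain ⟨n, x, g, hg⟩ := exists_dual_basis (Λ := Λ) P₁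
  obtain ⟨n', y, h, hh⟩ := exists_dual_basis (Λ := Λ) P₀
  constructor
  · intro H
    let : Module k M := Module.compHom M (algebraMap k Λᵐᵒᵖ)
    have : IsScalarTower k Λᵐᵒᵖ M := IsScalarTower.of_algebraMap_smul fun _ _ => rfl
    have : SMulCommClass Λᵐᵒᵖ k M := IsScalarTower.to_smulCommClass'
    by_contra hne
    push Not at hne
    obtain ⟨f, hf⟩ := hne
    let S : Submodule k (P₁ →ₗ[Λᵐᵒᵖ] M) := LinearMap.range (LinearMap.lcomp k M d)
    have hfS : f ∉ S := by
      rintro ⟨h, rfl⟩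
      exact hf h rfl
    -- A functional killing the maps that factor through `d`, but not `f`, induces `F m g = φ (m ·
    -- g)`. If `F = 0`, then `φ` vanishes on all `m · g`, and these span `Hom(P₁, M)` by the dual
    -- basis.
    obtain ⟨φ, hφf, hφS⟩ := Submodule.exists_le_ker_of_notMem hfS
    let F : M →ₗ[Λᵐᵒᵖ] StdDual k (TrRight Λ d) :=
      { toFun := fun m => (show TrRight Λ d →ₗ[k] k from
          (LinearMap.range (LinearMap.lcomp Λ Λ d)).restrictScalars k |>.liftQ
            { toFun := fun g => φ (orbitMap m ∘ₗ g)
              map_add' := fun g g' => by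
                rw [LinearMap.comp_add, map_add]
              map_smul' := fun a g => by
                rw [RingHom.id_apply, ← map_smul]
                congr 1
                ext p
                simp }
            (by
              rintro _ ⟨h, rfl⟩
              exact hφS ⟨orbitMap m ∘ₗ h, rfl⟩))
        map_add' := fun m m' => by
          apply LinearMap.ext
          intro t
          obtain ⟨g, rfl⟩ := Submodule.Quotient.mk_surjective _ t
          change φ _ = φ _ + φ _
          rw [← map_add]
          congr 1
          ext p
          simp
        map_smul' := fun c m => by
          apply LinearMap.ext
          intro t
          obtain ⟨g, rfl⟩ := Submodule.Quotient.mk_surjective _ t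
          change φ _ = φ _
          congr 1
          ext p
          change op (g p) • c • m = op (unop c * g p) • m
          rw [op_mul, mul_smul]; rfl }
    have hF : ∀ m g, φ (orbitMap m ∘ₗ g) = 0 := fun m g =>
      LinearMap.congr_fun (show (F m : TrRight Λ d →ₗ[k] k) = 0 from LinearMap.congr_fun (H F) m)
        (Submodule.Quotient.mk g)
    apply hφf
    have : f = ∑ i, orbitMap (f (x i)) ∘ₗ g i := by
      ext p
      conv_lhs => rw [← hg p]
      simp
    rw [this, map_sum]
    exact Finset.sum_eq_zero fun i _ => hF _ _
  · intro H F
    ext m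
    apply LinearMap.ext
    intro t
    obtain ⟨u, rfl⟩ := Submodule.Quotient.mk_surjective _ t
    change F m (Submodule.Quotient.mk u) = 0
    let β : M →+ (P₁ →ₗ[Λᵐᵒᵖ] Λ) →+ k := AddMonoidHom.mk' (fun m =>
      AddMonoidHom.mk' (fun u => F m (Submodule.Quotient.mk u)) (fun a b =>
        map_add (show TrRight Λ d →ₗ[k] k from F m) (Submodule.Quotient.mk a)
          (Submodule.Quotient.mk b))) (fun m m' => by ext u; simp only [map_add]; rfl)
    have hβ : ∀ (c : Λ) (m : M) (u : P₁ →ₗ[Λᵐᵒᵖ] Λ), β (op c • m) u = β m (c • u) := fun c m u => by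
      change F (op c • m) (Submodule.Quotient.mk u) = _
      rw [map_smul]; rfl
    have hβd : ∀ m w, β m (w ∘ₗ d) = 0 := fun m w => by
      change F m (Submodule.Quotient.mk (w ∘ₗ d)) = 0
      have h0 : (Submodule.Quotient.mk (w ∘ₗ d) : TrRight Λ d) = 0 :=
        (Submodule.Quotient.mk_eq_zero _).2 ⟨w, rfl⟩
      rw [h0]
      exact map_zero (show TrRight Λ d →ₗ[k] k from F m)
    have hu : u = ∑ i, u (x i) • g i := by
      ext p
      conv_lhs => rw [← hg p]
      simp
    obtain ⟨w, hw⟩ := H (orbitMap m ∘ₗ u)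
    have hx : ∀ i, op (u (x i)) • m = ∑ j, op (h j (d (x i))) • w (y j) := fun i => by
      have := LinearMap.congr_fun hw (x i)
      simp only [LinearMap.comp_apply, orbitMap_apply] at this
      rw [this]
      conv_lhs => rw [← hh (d (x i))]
      simp
    have hd : ∀ j, h j ∘ₗ d = ∑ i, h j (d (x i)) • g i := fun j => by
      ext p
      conv_lhs => rw [← hg p]
      simp
    change β m u = 0
    -- Expand `u` in the dual basis and move its coefficients onto `m`. There they become values of
    -- `w ∘ d`; expanding these in the dual basis of `P₀` moves everything onto maps `h j ∘ d`,
    -- which vanish in the transpose.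
    calc β m u = ∑ i, β m (u (x i) • g i) := by conv_lhs => rw [hu, map_sum]
      _ = ∑ i, ∑ j, β (w (y j)) (h j (d (x i)) • g i) := by
        refine Finset.sum_congr rfl fun i _ => ?_
        rw [← hβ, hx, map_sum, AddMonoidHom.finsetSum_apply]
        exact Finset.sum_congr rfl fun j _ => hβ _ _ _
      _ = ∑ j, β (w (y j)) (h j ∘ₗ d) := by
        rw [Finset.sum_comm]
        refine Finset.sum_congr rfl fun j _ => ?_
        rw [hd, map_sum]
      _ = 0 := Finset.sum_eq_zero fun j _ => hβd _ _

end DualBasis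

/-! ### Existence of projective covers -/

section Existence

variable {R : Type u} [Ring R] [IsNoetherianRing R] [IsArtinianRing R]

/-- The cover is a minimal member `S` among the projective submodules of a free module that still
map onto `M`. If `N + ker π = S`, lifting `π` through `N` gives an endomorphism `e` of `S` with
image in `N` and `π e = π`. By Fitting, the image of a high power of `e` is a direct summand mapping
onto `M`, so it is `S` by minimality. -/
theorem exists_isProjectiveCover (M : Type u) [AddCommGroup M] [Module R M] [Module.Finite R M] :
    ∃ (P : Type u) (_ : AddCommGroup P) (_ : Module R P) (π : P →ₗ[R] M),
      IsProjectiveCover R π := by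
  obtain ⟨n, p, hp⟩ := Module.Finite.exists_fin' R M
  let good : Set (Submodule R (Fin n → R)) :=
    {S | Module.Projective R S ∧ Submodule.map p S = ⊤}
  have htop : good.Nonempty := ⟨⊤, Module.Projective.of_equiv Submodule.topEquiv.symm,
    by rw [Submodule.map_top, LinearMap.range_eq_top.2 hp]⟩
  obtain ⟨S, ⟨hS, hSp⟩, hmin⟩ := IsArtinian.set_has_minimal good htop
  let π : S →ₗ[R] M := p ∘ₗ S.subtype
  have hπ : Function.Surjective π := by
    rw [← LinearMap.range_eq_top, LinearMap.range_comp, Submodule.range_subtype, hSp]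
  refine ⟨S, inferInstance, inferInstance, π, inferInstance, hS, hπ, fun N hN => ?_⟩
  have hπN : Function.Surjective (π ∘ₗ N.subtype) := by
    rw [← LinearMap.range_eq_top, LinearMap.range_comp, Submodule.range_subtype, ← top_le_iff,
      ← LinearMap.range_eq_top.2 hπ, ← Submodule.map_top, ← hN, Submodule.map_sup,
      show Submodule.map π (LinearMap.ker π) = ⊥ from
        (Submodule.map_le_iff_le_comap.2 le_rfl).antisymm bot_le, sup_bot_eq]
  obtain ⟨g, hg⟩ := Module.projective_lifting_property (π ∘ₗ N.subtype) π hπN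
  let e : Module.End R S := N.subtype ∘ₗ g
  have he : π ∘ₗ e = π := hg
  have hen : ∀ m, π ∘ₗ (e ^ m) = π := fun m => by
    induction m with
    | zero => rfl
    | succ m ih => rw [pow_succ, Module.End.mul_eq_comp, ← LinearMap.comp_assoc, ih, he]
  -- The exponent must be positive for the image of `e ^ m` to lie in `N`.
  obtain ⟨m, hm1, hm⟩ := ((Filter.eventually_ge_atTop 1).and
    (LinearMap.eventually_isCompl_ker_pow_range_pow e)).exists
  have hproj : Module.Projective R (LinearMap.range (e ^ m)) :=
    Module.Projective.of_split (LinearMap.range (e ^ m)).subtype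
      (Submodule.projectionOnto _ _ hm.symm) (Submodule.projectionOnto_comp_subtype _)
  have hmem : Submodule.map S.subtype (LinearMap.range (e ^ m)) ∈ good := by
    refine ⟨Module.Projective.of_equiv
      (Submodule.equivMapOfInjective S.subtype S.injective_subtype _), ?_⟩
    rw [← Submodule.map_comp]
    change Submodule.map π _ = ⊤
    rw [← LinearMap.range_comp, hen, LinearMap.range_eq_top.2 hπ]
  have hle : Submodule.map S.subtype (LinearMap.range (e ^ m)) ≤ S := Submodule.map_subtype_le _ _
  have heq : Submodule.map S.subtype (LinearMap.range (e ^ m)) = S :=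
    (hle.lt_or_eq).resolve_left (hmin _ hmem)
  rw [← top_le_iff]
  intro s _
  have hs : (s : Fin n → R) ∈ Submodule.map S.subtype (LinearMap.range (e ^ m)) :=
    heq.symm ▸ s.2
  obtain ⟨t, ⟨r, rfl⟩, ht⟩ := hs
  obtain rfl : (e ^ m) r = s := Subtype.ext ht
  obtain ⟨m, rfl⟩ := Nat.exists_eq_add_of_le' hm1
  rw [pow_succ']
  exact (g ((e ^ m) r)).2

theorem exists_isMinimalProjectivePresentation (M : Type u) [AddCommGroup M] [Module R M]
    [Module.Finite R M] :
    ∃ (P₁ P₀ : Type u) (_ : AddCommGroup P₁) (_ : Module R P₁) (_ : AddCommGroup P₀)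
      (_ : Module R P₀) (d₁ : P₁ →ₗ[R] P₀) (d₀ : P₀ →ₗ[R] M),
      IsMinimalProjectivePresentation R d₁ d₀ := by
  obtain ⟨P₀, _, _, d₀, h₀⟩ := exists_isProjectiveCover (R := R) M
  have := h₀.finite
  obtain ⟨P₁, _, _, d₁, h₁⟩ := exists_isProjectiveCover (R := R) (LinearMap.ker d₀)
  have hr : LinearMap.range ((LinearMap.ker d₀).subtype ∘ₗ d₁) = LinearMap.ker d₀ := by
    rw [LinearMap.range_comp, LinearMap.range_eq_top.2 h₁.surjective]; simp
  refine ⟨P₁, P₀, _, _, _, _, (LinearMap.ker d₀).subtype ∘ₗ d₁, d₀, hr, h₀,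
    h₁.finite, h₁.projective, LinearMap.surjective_rangeRestrict _, fun N hN => ?_⟩
  refine h₁.superfluous N ?_
  rwa [LinearMap.ker_rangeRestrict, LinearMap.ker_comp, Submodule.ker_subtype] at hN

end Existence

/-! ### Dimension shifting along injective objects -/

section Shift

universe w v u'

open Abelian

variable {A : Type u'} [Category.{v} A] [Abelian A] [HasExt.{w} A] {S : ShortComplex A}

/-- Positive-degree `Ext` into the injective middle term vanishes, so the connecting map is
injective in positive degrees and, by the next lemma, surjective in all degrees. -/
theorem eq_zero_of_comp_extClass_eq_zero (hS : S.ShortExact) [Injective S.X₂] {X : A} {n m : ℕ}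
    (hm : n + 1 + 1 = m) (x : Ext X S.X₃ (n + 1)) (hx : x.comp hS.extClass hm = 0) : x = 0 := by
  obtain ⟨y, rfl⟩ := Ext.covariant_sequence_exact₃ X hS x hm hx
  rw [y.eq_zero_of_injective, Ext.zero_comp]

theorem exists_comp_extClass_eq (hS : S.ShortExact) [Injective S.X₂] {X : A} {n m : ℕ}
    (hm : n + 1 = m) (y : Ext X S.X₁ m) : ∃ x : Ext X S.X₃ n, x.comp hS.extClass hm = y := by
  subst hm
  exact Ext.covariant_sequence_exact₁ X hS y (Ext.eq_zero_of_injective _) rfl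

theorem exists_retraction_of_extClass_eq_zero (hS : S.ShortExact) (h : hS.extClass = 0) :
    ∃ r : S.X₂ ⟶ S.X₁, S.f ≫ r = 𝟙 _ := by
  obtain ⟨y, hy⟩ := Ext.contravariant_sequence_exact₁ hS S.X₁ (Ext.mk₀ (𝟙 _)) (add_zero 1)
    (by rw [h, Ext.zero_comp])
  obtain ⟨r, rfl⟩ := Ext.addEquiv₀.symm.surjective y
  refine ⟨r, ?_⟩
  rw [Ext.addEquiv₀_symm_apply, Ext.mk₀_comp_mk₀] at hy
  exact Ext.addEquiv₀.symm.injective hy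

end Shift

theorem shortExact_of_linearMap {R : Type u} [Ring R] {X Y Z : Type u} [AddCommGroup X]
    [Module R X] [AddCommGroup Y] [Module R Y] [AddCommGroup Z] [Module R Z] (f : X →ₗ[R] Y)
    (g : Y →ₗ[R] Z) (hf : Function.Injective f) (hg : Function.Surjective g)
    (hfg : LinearMap.range f = LinearMap.ker g) :
    (ShortComplex.mk (ModuleCat.ofHom f) (ModuleCat.ofHom g) (ModuleCat.hom_ext
      (LinearMap.range_le_ker_iff.1 hfg.le))).ShortExact where
  exact := (ShortComplex.moduleCat_exact_iff_range_eq_ker _).2 hfg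
  mono_f := (ModuleCat.mono_iff_injective _).2 hf
  epi_g := (ModuleCat.epi_iff_surjective _).2 hg

/-! ### Duality -/

section Dual

variable {k C : Type u} [Field k] [Ring C] [Algebra k C]

section

variable {M : Type u} [AddCommGroup M] [Module k M]

instance : LinearMapClass (StdDual k M) k M k :=
  inferInstanceAs (LinearMapClass (M →ₗ[k] k) k M k)

instance : Module k (StdDual k M) := inferInstanceAs (Module k (M →ₗ[k] k))

theorem StdDual.ext {f g : StdDual k M} (h : ∀ m, f m = g m) : f = g := DFunLike.ext f g h

theorem StdDual.eq_of_forall_apply_eq {m m' : M} (h : ∀ f : StdDual k M, f m = f m') :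
    m = m' := by
  rw [← sub_eq_zero, ← Module.forall_dual_apply_eq_zero_iff k]
  intro f
  exact (map_sub f m m').trans (sub_eq_zero.2 (h f))

theorem StdDual.exists_apply_eq [FiniteDimensional k M] (φ : StdDual k M →ₗ[k] k) :
    ∃ m : M, ∀ f : StdDual k M, φ f = f m :=
  ⟨(Module.evalEquiv k M).symm φ, fun f => (Module.apply_evalEquiv_symm_apply k M f φ).symm⟩

end

variable {Q Q' : Type u} [AddCommGroup Q] [Module k Q] [Module C Q] [IsScalarTower k C Q]
  [AddCommGroup Q'] [Module k Q'] [Module C Q'] [IsScalarTower k C Q']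
  {M : Type u} [AddCommGroup M] [Module k M] [Module Cᵐᵒᵖ M] [IsScalarTower k Cᵐᵒᵖ M]

theorem map_field_smul_left (f : Q →ₗ[C] Q') (a : k) (q : Q) : f (a • q) = a • f q := by
  rw [← algebraMap_smul C a q, map_smul, algebraMap_smul]

/-- The dual of a map of left modules. -/
def stdDualMap (f : Q →ₗ[C] Q') : StdDual k Q' →ₗ[Cᵐᵒᵖ] StdDual k Q where
  toFun φ := (show Q →ₗ[k] k from
    { toFun := fun q => φ (f q)
      map_add' := fun q q' => by
        rw [map_add, map_add]
      map_smul' := fun a q => by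
        rw [map_field_smul_left, map_smul]; rfl })
  map_add' _ _ := rfl
  map_smul' c φ := StdDual.ext fun q => congrArg φ (map_smul f (unop c) q).symm

@[simp] theorem stdDualMap_apply (f : Q →ₗ[C] Q') (φ : StdDual k Q') (q : Q) :
    stdDualMap f φ q = φ (f q) := rfl

theorem stdDualMap_injective {f g : Q →ₗ[C] Q'}
    (h : stdDualMap (k := k) f = stdDualMap g) : f = g :=
  LinearMap.ext fun q => StdDual.eq_of_forall_apply_eq fun φ =>
    DFunLike.congr_fun (LinearMap.congr_fun h φ) q

theorem StdDual.op_algebraMap_smul (a : k) (φ : StdDual k Q) :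
    op (algebraMap k C a) • φ = a • φ := StdDual.ext fun q => by
  rw [StdDual.op_smul_apply, algebraMap_smul, map_smul]; rfl

/-- Every map between duals of finite-dimensional modules is the dual of a map. -/
theorem exists_stdDualMap_eq [FiniteDimensional k Q'] (u : StdDual k Q' →ₗ[Cᵐᵒᵖ] StdDual k Q) :
    ∃ f : Q →ₗ[C] Q', stdDualMap f = u := by
  have hex : ∀ q : Q, ∃ q' : Q', ∀ φ : StdDual k Q', u φ q = φ q' := fun q =>
    StdDual.exists_apply_eq
      { toFun := fun φ => u φ q
        map_add' := fun φ ψ => by rw [map_add u φ ψ]; rfl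
        map_smul' := fun a φ => by
          rw [← StdDual.op_algebraMap_smul (C := C), map_smul, StdDual.op_algebraMap_smul]; rfl }
  choose f hf using hex
  refine ⟨{ toFun := f
            map_add' := fun x y => StdDual.eq_of_forall_apply_eq (k := k) fun φ => ?_
            map_smul' := fun c x => StdDual.eq_of_forall_apply_eq (k := k) fun φ => ?_ }, ?_⟩
  · rw [← hf, map_add, map_add, hf, hf]
  · rw [← hf, RingHom.id_apply, ← StdDual.op_smul_apply c φ, ← hf, map_smul u]
    rfl
  · ext φ
    exact StdDual.ext fun q => (hf q φ).symm

theorem map_field_smul_right (g : M →ₗ[Cᵐᵒᵖ] StdDual k Q) (a : k) (m : M) (q : Q) :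
    g (a • m) q = a • g m q := by
  rw [← algebraMap_smul Cᵐᵒᵖ a m, map_smul]
  change g m (algebraMap k C a • q) = _
  rw [algebraMap_smul]
  exact map_smul (g m) a q

/-- The transpose `Q → D M` of `M → D Q`, for a left module `Q` and a right module `M`. -/
def transposeLeft (g : M →ₗ[Cᵐᵒᵖ] StdDual k Q) : Q →ₗ[C] StdDual k M where
  toFun q := (show M →ₗ[k] k from
    { toFun := fun m => g m q
      map_add' := fun m m' => by rw [map_add]; rfl
      map_smul' := fun a m => map_field_smul_right g a m q })
  map_add' q q' := StdDual.ext fun m => map_add (g m) q q'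
  map_smul' c q := StdDual.ext fun m => by
    change g m (c • q) = g (op c • m) q
    rw [map_smul g]; rfl

/-- The transpose `M → D Q` of `Q → D M`, for a left module `Q` and a right module `M`. -/
def transposeRight (g : Q →ₗ[C] StdDual k M) : M →ₗ[Cᵐᵒᵖ] StdDual k Q where
  toFun m := (show Q →ₗ[k] k from
    { toFun := fun q => g q m
      map_add' := fun q q' => by rw [map_add]; rfl
      map_smul' := fun a q => by
        rw [← algebraMap_smul C a q, map_smul]
        change g q (op (algebraMap k C a) • m) = _
        change g q (algebraMap k Cᵐᵒᵖ a • m) = _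
        rw [algebraMap_smul]
        exact map_smul (g q) a m })
  map_add' m m' := StdDual.ext fun q => map_add (g q) m m'
  map_smul' c m := StdDual.ext fun q => by
    change g q (c • m) = g (unop c • q) m
    rw [map_smul g]; rfl

@[simp] theorem transposeLeft_apply (g : M →ₗ[Cᵐᵒᵖ] StdDual k Q) (q : Q) (m : M) :
    transposeLeft g q m = g m q := rfl

@[simp] theorem transposeRight_apply (g : Q →ₗ[C] StdDual k M) (m : M) (q : Q) :
    transposeRight g m q = g q m := rfl

/-- Transposition turns extending a map to `DQ` along `f` into lifting a map from `Q` along `Df`.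
The map `Df` is onto because `k` is a field, and `Q` is projective. -/
theorem injective_stdDual [Module.Projective C Q] : Module.Injective Cᵐᵒᵖ (StdDual k Q) where
  out X Y _ _ _ _ f hf g := by
    let : Module k X := Module.compHom X (algebraMap k Cᵐᵒᵖ)
    have : IsScalarTower k Cᵐᵒᵖ X := IsScalarTower.of_algebraMap_smul fun _ _ => rfl
    let : Module k Y := Module.compHom Y (algebraMap k Cᵐᵒᵖ)
    have : IsScalarTower k Cᵐᵒᵖ Y := IsScalarTower.of_algebraMap_smul fun _ _ => rfl
    let fk : X →ₗ[k] Y := f.restrictScalars k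
    let Df : StdDual k Y →ₗ[C] StdDual k X :=
      { toFun := fun φ => (show Y →ₗ[k] k from φ) ∘ₗ fk
        map_add' := fun _ _ => rfl
        map_smul' := fun c φ => StdDual.ext fun x => congrArg φ (map_smul f (op c) x).symm }
    have hDf : Function.Surjective Df := fun φ => by
      obtain ⟨l, hl⟩ := fk.exists_leftInverse_of_injective (LinearMap.ker_eq_bot.2 hf)
      refine ⟨(show X →ₗ[k] k from φ) ∘ₗ l, StdDual.ext fun x => ?_⟩
      exact congrArg φ (LinearMap.congr_fun hl x)
    obtain ⟨h, hh⟩ := Module.projective_lifting_property Df (transposeLeft g) hDf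
    refine ⟨transposeRight h, fun x => StdDual.ext fun q => ?_⟩
    exact DFunLike.congr_fun (LinearMap.congr_fun hh q) x

end Dual

/-! ### The second extension group as a cokernel -/

section ExtTwo

variable {k C : Type u} [Field k] [Ring C] [Algebra k C]

instance {Q : Type u} [AddCommGroup Q] [Module k Q] [Module C Q] [IsScalarTower k C Q] :
    IsScalarTower k Cᵐᵒᵖ (StdDual k Q) :=
  IsScalarTower.of_algebraMap_smul fun a φ => StdDual.op_algebraMap_smul a φ

instance {Q : Type u} [AddCommGroup Q] [Module k Q] [FiniteDimensional k Q] :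
    FiniteDimensional k (StdDual k Q) := inferInstanceAs (FiniteDimensional k (Module.Dual k Q))

variable {Q₁ Q₀ W : Type u} [AddCommGroup Q₁] [Module k Q₁] [Module C Q₁] [IsScalarTower k C Q₁]
  [AddCommGroup Q₀] [Module k Q₀] [Module C Q₀] [IsScalarTower k C Q₀]
  [AddCommGroup W] [Module k W] [Module Cᵐᵒᵖ W] [IsScalarTower k Cᵐᵒᵖ W]

/-- Together with `range_transposeRight`, this turns a presentation of `DW` into the exact sequence
`0 → W → DQ₀ → DQ₁`. -/
theorem transposeRight_injective {d₀ : Q₀ →ₗ[C] StdDual k W} (h₀ : Function.Surjective d₀) :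
    Function.Injective (transposeRight d₀) := fun w w' h =>
  StdDual.eq_of_forall_apply_eq (k := k) fun φ => by
    obtain ⟨q, rfl⟩ := h₀ φ
    exact DFunLike.congr_fun h q

theorem mem_range_stdDualMap_iff {d : Q₁ →ₗ[C] Q₀} {φ : StdDual k Q₁} :
    φ ∈ LinearMap.range (stdDualMap (k := k) d) ↔ ∀ q, d q = 0 → φ q = 0 := by
  constructor
  · rintro ⟨ψ, rfl⟩ q hq
    rw [stdDualMap_apply, hq, map_zero]
  · intro h
    have h' : (show Q₁ →ₗ[k] k from φ) ∈
        LinearMap.range (d.restrictScalars k).dualMap := by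
      rw [LinearMap.range_dualMap_eq_dualAnnihilator_ker, Submodule.mem_dualAnnihilator]
      exact h
    obtain ⟨ψ, hψ⟩ := h'
    exact ⟨ψ, hψ⟩

theorem range_transposeRight [FiniteDimensional k W] {d₁ : Q₁ →ₗ[C] Q₀}
    {d₀ : Q₀ →ₗ[C] StdDual k W} (hd : LinearMap.range d₁ = LinearMap.ker d₀) :
    LinearMap.range (transposeRight d₀) = LinearMap.ker (stdDualMap (k := k) d₁) := by
  ext φ
  rw [LinearMap.mem_ker]
  constructor
  · rintro ⟨w, rfl⟩
    refine StdDual.ext fun q => ?_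
    rw [stdDualMap_apply, transposeRight_apply,
      show d₀ (d₁ q) = 0 from hd.le (LinearMap.mem_range_self d₁ q)]
    rfl
  · intro h
    have hker : ∀ q, d₀ q = 0 → φ q = 0 := fun q hq => by
      obtain ⟨p, rfl⟩ := hd.ge hq
      exact DFunLike.congr_fun h p
    let d₀' : Q₀ →ₗ[k] StdDual k W :=
      { toFun := d₀
        map_add' := map_add d₀
        map_smul' := fun a q => StdDual.ext fun w => by
          rw [← algebraMap_smul C a q, map_smul, StdDual.smul_apply]
          change d₀ q (algebraMap k Cᵐᵒᵖ a • w) = a * d₀ q w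
          rw [algebraMap_smul, map_smul]; rfl }
    have h' : (show Q₀ →ₗ[k] k from φ) ∈ LinearMap.range d₀'.dualMap := by
      rw [LinearMap.range_dualMap_eq_dualAnnihilator_ker, Submodule.mem_dualAnnihilator]
      exact hker
    obtain ⟨ψ, hψ⟩ := h'
    obtain ⟨w, hw⟩ := StdDual.exists_apply_eq (k := k) ψ
    refine ⟨w, StdDual.ext fun q => ?_⟩
    rw [transposeRight_apply, ← hw]
    exact DFunLike.congr_fun hψ q

theorem dualLeftMul_comp_stdDualMap (c : C) (h : Q₁ →ₗ[C] C) :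
    ModuleCat.ofHom (stdDualMap (k := k) (op c • h)) =
      dualLeftMul k c ≫ ModuleCat.ofHom (stdDualMap h) := rfl

/-- `Ext²(DC, M)`, in the category of right `C`-modules. -/
abbrev ExtTwo (k C M : Type u) [Field k] [Ring C] [Algebra k C] [AddCommGroup M]
    [Module Cᵐᵒᵖ M] : Type u :=
  Abelian.Ext.{u} (ModuleCat.of Cᵐᵒᵖ (StdDual k C)) (ModuleCat.of Cᵐᵒᵖ M) 2

variable [FiniteDimensional k C] {P I : Type u} [AddCommGroup P] [Module Cᵐᵒᵖ P]
  [AddCommGroup I] [Module Cᵐᵒᵖ I]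

/-- In global dimension two, a minimal projective presentation of the dual of a first cosyzygy is
a resolution. -/
theorem stdDualMap_surjective (hC : GlobalDimensionLE C 2) [FiniteDimensional k W]
    [Module.Injective Cᵐᵒᵖ I] {i : P →ₗ[Cᵐᵒᵖ] I} {p : I →ₗ[Cᵐᵒᵖ] W}
    (hi : Function.Injective i) (hp : Function.Surjective p)
    (hip : LinearMap.range i = LinearMap.ker p)
    {d₁ : Q₁ →ₗ[C] Q₀} {d₀ : Q₀ →ₗ[C] StdDual k W}
    (h : IsMinimalProjectivePresentation C d₁ d₀) :
    Function.Surjective (stdDualMap (k := k) d₁) := by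
  have := h.cover₀.projective
  have := h.cover₁.finite
  have : Module.Finite k Q₁ := Module.Finite.trans C Q₁
  have hI : Injective (ModuleCat.of Cᵐᵒᵖ I) := (Module.injective_iff_injective_object _ _).1 ‹_›
  have hQ : Injective (ModuleCat.of Cᵐᵒᵖ (StdDual k Q₀)) :=
    (Module.injective_iff_injective_object _ _).1 injective_stdDual
  let D := stdDualMap (k := k) d₁
  let J : Submodule Cᵐᵒᵖ (StdDual k Q₁) := LinearMap.range D
  have hS₁ := shortExact_of_linearMap i p hi hp hip
  have hS₂ := shortExact_of_linearMap (transposeRight d₀) D.rangeRestrict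
    (transposeRight_injective h.cover₀.surjective) (LinearMap.surjective_rangeRestrict D)
    (by rw [LinearMap.ker_rangeRestrict, range_transposeRight h.exact])
  have hS₃ := shortExact_of_linearMap J.subtype J.mkQ J.injective_subtype J.mkQ_surjective
    (by rw [Submodule.range_subtype, Submodule.ker_mkQ])
  have : Module.Finite Cᵐᵒᵖ (StdDual k Q₁) := Module.Finite.of_restrictScalars_finite k _ _
  have := hC (StdDual k Q₁ ⧸ J)
  -- With `J` the image of `DQ₀ → DQ₁`, this class in `Ext¹(DQ₁/J, J)` embeds by two shifts into
  -- `Ext³(DQ₁/J, P) = 0`. Hence `J` is a direct summand of `DQ₁`.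
  have hext : hS₃.extClass = 0 := by
    refine eq_zero_of_comp_extClass_eq_zero hS₂ (n := 0) rfl _ ?_
    refine eq_zero_of_comp_extClass_eq_zero hS₁ (n := 1) rfl _ ?_
    exact Abelian.Ext.eq_zero_of_hasProjectiveDimensionLT _ 3 le_rfl
  obtain ⟨r, hr⟩ := exists_retraction_of_extClass_eq_zero hS₃ hext
  let r' : StdDual k Q₁ →ₗ[Cᵐᵒᵖ] J := r.hom
  have hr' : ∀ j : J, r' j = j := fun j => LinearMap.congr_fun (congrArg ModuleCat.Hom.hom hr) j
  -- `N` is the subspace of `Q₁` annihilated by the complement `ker r'`. The annihilator of `N + ker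
  -- d₁` is `ker r' ∩ J = 0`, so the sum is `Q₁`. Minimality then forces `N = Q₁`, that is, `ker r'
  -- = 0`.
  let N : Submodule C Q₁ :=
    { carrier := {q | ∀ ψ, r' ψ = 0 → ψ q = 0}
      zero_mem' := fun ψ _ => map_zero ψ
      add_mem' := fun {a b} ha hb ψ hψ => by rw [map_add, ha ψ hψ, hb ψ hψ, add_zero]
      smul_mem' := fun c q hq ψ hψ => by
        rw [← StdDual.op_smul_apply]
        exact hq _ (by rw [map_smul, hψ, smul_zero]) }
  have hN : N ⊔ LinearMap.ker d₁ = ⊤ := by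
    by_contra hne
    have hne' : ∃ q, q ∉ N ⊔ LinearMap.ker d₁ := by
      by_contra! hall
      exact hne (Submodule.eq_top_iff'.2 hall)
    obtain ⟨q, hq⟩ := hne'
    obtain ⟨f, hfq, hf⟩ := Submodule.exists_le_ker_of_notMem
      (p := (N ⊔ LinearMap.ker d₁).restrictScalars k) hq
    let φ : StdDual k Q₁ := f
    have hφJ : φ ∈ J := mem_range_stdDualMap_iff.2 fun x hx =>
      hf ((le_sup_right : LinearMap.ker d₁ ≤ _) hx)
    have hφr : r' φ = 0 := by
      let A : Subspace k (Module.Dual k Q₁) :=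
        { carrier := {ψ | r' ψ = 0}
          zero_mem' := map_zero r'
          add_mem' := fun {a b} ha hb => (map_add r' a b).trans ((congrArg₂ _ ha hb).trans (add_zero 0))
          smul_mem' := fun a ψ hψ => by
            change r' (a • (show StdDual k Q₁ from ψ)) = 0
            rw [← StdDual.op_algebraMap_smul (C := C), map_smul, hψ, smul_zero] }
      have hA : f ∈ A.dualCoannihilator.dualAnnihilator := by
        rw [Submodule.mem_dualAnnihilator]
        intro x hx
        refine hf ((le_sup_left : N ≤ _) ?_)
        exact (Submodule.mem_dualCoannihilator x).1 hx
      rw [Subspace.dualCoannihilator_dualAnnihilator_eq] at hA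
      exact hA
    have h0 : φ = 0 := by
      rw [hr' ⟨φ, hφJ⟩] at hφr
      exact congrArg Subtype.val hφr
    exact hfq (DFunLike.congr_fun h0 q)
  have hNtop : N = ⊤ := h.cover₁.superfluous N (by rwa [LinearMap.ker_rangeRestrict])
  intro ψ
  have hz : ψ - (r' ψ : StdDual k Q₁) = 0 := StdDual.ext fun q => by
    have hq : q ∈ N := hNtop ▸ Submodule.mem_top
    exact hq _ (by rw [map_sub, hr', sub_self])
  rw [sub_eq_zero.1 hz]
  exact (r' ψ).2

/-- `Tr W' ≅ Ext²(DC, P)`, when `W'` is the dual of the first cosyzygy of `P`. -/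
theorem exists_trLeft_equiv_extTwo (hC : GlobalDimensionLE C 2) [FiniteDimensional k W]
    [Module.Injective Cᵐᵒᵖ I] {i : P →ₗ[Cᵐᵒᵖ] I} {p : I →ₗ[Cᵐᵒᵖ] W}
    (hi : Function.Injective i) (hp : Function.Surjective p)
    (hip : LinearMap.range i = LinearMap.ker p)
    {d₁ : Q₁ →ₗ[C] Q₀} {d₀ : Q₀ →ₗ[C] StdDual k W}
    (h : IsMinimalProjectivePresentation C d₁ d₀) :
    ∃ e : TrLeft C d₁ ≃+ ExtTwo k C P, ∀ (c : C) (t : TrLeft C d₁),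
      e (op c • t) = (Abelian.Ext.mk₀ (dualLeftMul k c)).comp (e t) (zero_add 2) := by
  have := h.cover₀.projective
  have := h.cover₀.finite
  have : Module.Finite k Q₀ := Module.Finite.trans C Q₀
  have hI : Injective (ModuleCat.of Cᵐᵒᵖ I) := (Module.injective_iff_injective_object _ _).1 ‹_›
  have hQ : Injective (ModuleCat.of Cᵐᵒᵖ (StdDual k Q₀)) :=
    (Module.injective_iff_injective_object _ _).1 injective_stdDual
  have hS₁ := shortExact_of_linearMap i p hi hp hip
  have hS₂ := shortExact_of_linearMap (transposeRight d₀) (stdDualMap (k := k) d₁)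
    (transposeRight_injective h.cover₀.surjective) (stdDualMap_surjective hC hi hp hip h)
    (range_transposeRight h.exact)
  -- The map `f` goes to `Df : DC → DQ₁`, followed by the connecting maps to `Ext¹(DC, W)` and
  -- `Ext²(DC, P)`. Both are onto and the second is injective; the first kills exactly the maps
  -- factoring through `DQ₀`, i.e. the `f` factoring through `d₁`.
  let Ψ : (Q₁ →ₗ[C] C) →+ ExtTwo k C P := AddMonoidHom.mk' (fun f =>
    ((Abelian.Ext.mk₀ (ModuleCat.ofHom (stdDualMap (k := k) f))).comp hS₂.extClass
      (zero_add 1)).comp hS₁.extClass rfl) (fun f g => by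
        rw [← Abelian.Ext.add_comp, ← Abelian.Ext.add_comp, ← Abelian.Ext.mk₀_add]
        congr 3
        ext φ
        exact StdDual.ext fun q => map_add φ (f q) (g q))
  have hΨsurj : Function.Surjective Ψ := fun y => by
    obtain ⟨y₁, rfl⟩ := exists_comp_extClass_eq hS₁ (n := 1) rfl y
    obtain ⟨y₀, rfl⟩ := exists_comp_extClass_eq hS₂ (n := 0) rfl y₁
    obtain ⟨v, rfl⟩ := Abelian.Ext.addEquiv₀.symm.surjective y₀
    obtain ⟨f, hf⟩ := exists_stdDualMap_eq (k := k) (C := C) (Q := Q₁) (Q' := C) v.hom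
    refine ⟨f, ?_⟩
    change ((Abelian.Ext.mk₀ (ModuleCat.ofHom (stdDualMap (k := k) f))).comp hS₂.extClass
      (zero_add 1)).comp hS₁.extClass rfl = _
    rw [hf]
    rfl
  have hΨker : ∀ f, Ψ f = 0 ↔ f ∈ LinearMap.range (LinearMap.lcomp Cᵐᵒᵖ C d₁) := fun f => by
    constructor
    · intro hf
      have hf₁ := eq_zero_of_comp_extClass_eq_zero hS₁ (n := 0) rfl _ hf
      obtain ⟨x, hx⟩ := Abelian.Ext.covariant_sequence_exact₃ _ hS₂ _ _ hf₁
      obtain ⟨v, rfl⟩ := Abelian.Ext.addEquiv₀.symm.surjective x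
      rw [Abelian.Ext.addEquiv₀_symm_apply, Abelian.Ext.mk₀_comp_mk₀] at hx
      have hx' := Abelian.Ext.addEquiv₀.symm.injective hx
      obtain ⟨g, hg⟩ := exists_stdDualMap_eq (k := k) (C := C) (Q := Q₀) (Q' := C) v.hom
      refine ⟨g, stdDualMap_injective (k := k) ?_⟩
      have hx'' := congrArg ModuleCat.Hom.hom hx'
      refine Eq.trans ?_ hx''
      change _ = stdDualMap d₁ ∘ₗ v.hom
      rw [← hg]
      rfl
    · rintro ⟨g, rfl⟩
      have hg : ModuleCat.ofHom (stdDualMap (k := k) (g ∘ₗ d₁)) =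
        ModuleCat.ofHom (stdDualMap (k := k) g) ≫ ModuleCat.ofHom (stdDualMap (k := k) d₁) := rfl
      change ((Abelian.Ext.mk₀ (ModuleCat.ofHom (stdDualMap (k := k) (g ∘ₗ d₁)))).comp hS₂.extClass
        (zero_add 1)).comp hS₁.extClass rfl = _
      rw [hg, ← Abelian.Ext.mk₀_comp_mk₀, Abelian.Ext.comp_assoc_of_second_deg_zero,
        hS₂.comp_extClass, Abelian.Ext.comp_zero, Abelian.Ext.zero_comp]
  let Ψ' : TrLeft C d₁ →+ ExtTwo k C P :=
    QuotientAddGroup.lift _ Ψ (fun f hf => (hΨker f).2 hf)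
  refine ⟨AddEquiv.ofBijective Ψ' ⟨?_, ?_⟩, ?_⟩
  · rw [injective_iff_map_eq_zero]
    intro t ht
    obtain ⟨f, rfl⟩ := Submodule.Quotient.mk_surjective _ t
    exact (Submodule.Quotient.mk_eq_zero _).2 ((hΨker f).1 ht)
  · intro y
    obtain ⟨f, rfl⟩ := hΨsurj y
    exact ⟨Submodule.Quotient.mk f, rfl⟩
  · intro c t
    obtain ⟨f, rfl⟩ := Submodule.Quotient.mk_surjective _ t
    change Ψ (op c • f) = (Abelian.Ext.mk₀ (dualLeftMul k c)).comp (Ψ f) (zero_add 2)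
    change ((Abelian.Ext.mk₀ (ModuleCat.ofHom (stdDualMap (k := k) (op c • f)))).comp hS₂.extClass
      (zero_add 1)).comp hS₁.extClass rfl = (Abelian.Ext.mk₀ (dualLeftMul k c)).comp
        (((Abelian.Ext.mk₀ (ModuleCat.ofHom (stdDualMap (k := k) f))).comp hS₂.extClass
      (zero_add 1)).comp hS₁.extClass rfl) (zero_add 2)
    rw [dualLeftMul_comp_stdDualMap, ← Abelian.Ext.mk₀_comp_mk₀,
      Abelian.Ext.comp_assoc _ _ _ _ (zero_add 1) (by lia),
      Abelian.Ext.comp_assoc _ _ _ _ _ (by lia)]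

end ExtTwo

/-! ### Finite dimensionality of the relation extension -/

section Finite

variable {k C : Type u} [Field k] [Ring C] [Algebra k C] [FiniteDimensional k C]

/-- `Hom` embeds in a finite power of `N` by evaluation on generators of `M`; in higher degree, a
free cover of `M` presents `Ext` as a quotient of the preceding one for its kernel. This makes `B`
finite-dimensional, so projective covers over it exist. -/
theorem finite_ext (M N : Type u) [AddCommGroup M] [Module Cᵐᵒᵖ M] [Module.Finite Cᵐᵒᵖ M]
    [AddCommGroup N] [Module Cᵐᵒᵖ N] [Module.Finite Cᵐᵒᵖ N] (n : ℕ) :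
    Module.Finite k (Abelian.Ext.{u} (ModuleCat.of Cᵐᵒᵖ M) (ModuleCat.of Cᵐᵒᵖ N) n) := by
  have : Module.Finite k Cᵐᵒᵖ := Module.Finite.equiv (opLinearEquiv k)
  have : IsNoetherianRing Cᵐᵒᵖ := IsNoetherianRing.of_finite k Cᵐᵒᵖ
  induction n generalizing M with
  | zero =>
    let : Module k N := RestrictScalars.module k Cᵐᵒᵖ N
    have : IsScalarTower k Cᵐᵒᵖ N := RestrictScalars.isScalarTower k Cᵐᵒᵖ N
    have : Module.Finite k N := Module.Finite.trans Cᵐᵒᵖ N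
    obtain ⟨n, p, hp⟩ := Module.Finite.exists_fin' Cᵐᵒᵖ M
    let φ : (ModuleCat.of Cᵐᵒᵖ M ⟶ ModuleCat.of Cᵐᵒᵖ N) →ₗ[k]
        (Fin n → N) :=
      { toFun := fun f i => f.hom (p (Pi.single i 1))
        map_add' := fun _ _ => rfl
        map_smul' := fun _ _ => rfl }
    have hφ : Function.Injective φ := fun f g hfg => by
      have h : f.hom ∘ₗ p = g.hom ∘ₗ p := LinearMap.pi_ext' fun i => LinearMap.ext_ring
        (congrFun hfg i)
      ext x
      obtain ⟨y, rfl⟩ := hp x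
      exact LinearMap.congr_fun h y
    have := Module.Finite.of_injective φ hφ
    exact Module.Finite.equiv (Abelian.Ext.linearEquiv₀ (R := k)).symm
  | succ n ih =>
    obtain ⟨m, p, hp⟩ := Module.Finite.exists_fin' Cᵐᵒᵖ M
    have hS := shortExact_of_linearMap (LinearMap.ker p).subtype p
      (LinearMap.ker p).injective_subtype hp (Submodule.range_subtype _)
    have := ih (LinearMap.ker p)
    have hproj : Projective (ModuleCat.of Cᵐᵒᵖ (Fin m → Cᵐᵒᵖ)) :=
      ModuleCat.projective_of_categoryTheory_projective _
    refine Module.Finite.of_surjective (hS.extClass.precompOfLinear k _ (add_comm 1 n))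
      fun y => ?_
    exact Abelian.Ext.contravariant_sequence_exact₃ hS _ y
      (Abelian.Ext.eq_zero_of_projective _) (add_comm 1 n)

instance : Module.Finite k (RelationBimodule k C) := by
  have : Module.Finite Cᵐᵒᵖ (StdDual k C) := Module.Finite.of_restrictScalars_finite k _ _
  have : Module.Finite Cᵐᵒᵖ C :=
    Module.Finite.of_surjective (M := Cᵐᵒᵖ)
      (show Cᵐᵒᵖ →ₗ[Cᵐᵒᵖ] C from
        { toFun := unop, map_add' := fun _ _ => rfl, map_smul' := fun _ _ => rfl })
      unop_surjective
  have := finite_ext (k := k) (C := C) (StdDual k C) C 2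
  refine Module.Finite.of_surjective (show ExtDual k C →ₗ[k] RelationBimodule k C from
    { toFun := fun e => (e : RelationBimodule k C)
      map_add' := fun _ _ => rfl
      map_smul' := fun a e => ?_ }) Function.surjective_id
  -- The `k`-structure of the linear category and the one through left multiplication on `C` agree,
  -- both being composition with the scalar endomorphism of `C`.
  obtain ⟨s, hs, hsmul⟩ : ∃ s : (X : ModuleCat.{u} Cᵐᵒᵖ) → (X ⟶ X),
      (∀ (X : ModuleCat.{u} Cᵐᵒᵖ) (x : X), (s X).hom x = op (algebraMap k C a) • x) ∧
      ∀ (X Y : ModuleCat.{u} Cᵐᵒᵖ) (e : Abelian.Ext X Y 2),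
        a • e = e.comp (Abelian.Ext.mk₀ (s Y)) (add_zero 2) :=
    ⟨fun X => a • 𝟙 X, fun _ _ => rfl, fun _ _ e => Abelian.Ext.smul_eq_comp_mk₀ e a⟩
  have h : leftMul (algebraMap k C a) = s _ :=
    ModuleCat.hom_ext (LinearMap.ext fun x =>
      (Algebra.commutes a (show C from x)).trans (hs (ModuleCat.of Cᵐᵒᵖ C) x).symm)
  change a • e = e.comp (Abelian.Ext.mk₀ (leftMul (algebraMap k C a))) (add_zero 2)
  rw [h, hsmul]

instance : Module.Finite k (RelationExtension k C)ᵐᵒᵖ :=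
  have : Module.Finite k (RelationExtension k C) :=
    inferInstanceAs (Module.Finite k (C × RelationBimodule k C))
  Module.Finite.equiv (opLinearEquiv k)

instance : IsNoetherianRing (RelationExtension k C)ᵐᵒᵖ :=
  IsNoetherianRing.of_finite k _

instance : IsArtinianRing (RelationExtension k C)ᵐᵒᵖ :=
  IsArtinianRing.of_finite k _

end Finite

/-! ### Modules over the relation extension -/

section Extension

variable {k C : Type u} [Field k] [Ring C] [Algebra k C]

variable {M N : Type u} [AddCommGroup M] [Module Cᵐᵒᵖ M] [AddCommGroup N] [Module Cᵐᵒᵖ N]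
  {P₀ : Type u} [AddCommGroup P₀] [Module (RelationExtension k C)ᵐᵒᵖ P₀]

/-- A map of right `C`-modules, as a map of modules over the relation extension. -/
def viaBMap (f : M →ₗ[Cᵐᵒᵖ] N) : ViaB k C M →ₗ[(RelationExtension k C)ᵐᵒᵖ] ViaB k C N where
  toFun := f
  map_add' := map_add f
  map_smul' b m := map_smul f (op (unop b).fst) (show M from m)

/-- The projection `C ⋉ E → C`, as a map of right modules. -/
def fstViaB : RelationExtension k C →ₗ[(RelationExtension k C)ᵐᵒᵖ] ViaB k C C where
  toFun := TrivSqZeroExt.fst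
  map_add' _ _ := rfl
  map_smul' _ _ := rfl

/-- Lifting along a surjection from a module over the relation extension. -/
theorem exists_lift_via_inl [Module.Projective Cᵐᵒᵖ M] (f : M →ₗ[Cᵐᵒᵖ] N)
    (q : P₀ →ₗ[(RelationExtension k C)ᵐᵒᵖ] ViaB k C N) (hq : Function.Surjective q) :
    ∃ s : M →+ P₀, (∀ (c : C) (m : M), s (op c • m) =
        op (TrivSqZeroExt.inl c : RelationExtension k C) • s m) ∧
      ∀ m, q (s m) = f m := by
  let : Module Cᵐᵒᵖ P₀ := Module.compHom P₀
    (RingHom.op (TrivSqZeroExt.inlHom C (RelationBimodule k C)))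
  let q' : P₀ →ₗ[Cᵐᵒᵖ] N :=
    { toFun := q
      map_add' := map_add q
      map_smul' := fun c x => map_smul q (op (TrivSqZeroExt.inl (unop c) : RelationExtension k C)) x }
  obtain ⟨s, hs⟩ := Module.projective_lifting_property q' f hq
  exact ⟨s.toAddMonoidHom, fun c m => map_smul s (op c) m, LinearMap.congr_fun hs⟩

variable {P : Type u} [AddCommGroup P] [Module Cᵐᵒᵖ P] [Module.Projective Cᵐᵒᵖ P]
  {d₀ : P₀ →ₗ[(RelationExtension k C)ᵐᵒᵖ] ViaB k C P}

/-- Maps from the projective cover of a projective right `C`-module `P` to right `C`-modules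
factor through `P`. -/
theorem exists_section_of_isProjectiveCover (h : IsProjectiveCover (RelationExtension k C)ᵐᵒᵖ d₀) :
    ∃ s : P →+ P₀, (∀ (c : C) (p : P), s (op c • p) =
        op (TrivSqZeroExt.inl c : RelationExtension k C) • s p) ∧
      (∀ p, d₀ (s p) = p) ∧
      ∀ (M : Type u) [AddCommGroup M] [Module Cᵐᵒᵖ M]
        (f : P₀ →ₗ[(RelationExtension k C)ᵐᵒᵖ] ViaB k C M) (x : P₀), f x = f (s (d₀ x)) := by
  obtain ⟨s, hs, hs'⟩ := exists_lift_via_inl (LinearMap.id (R := Cᵐᵒᵖ) (M := P)) d₀ h.surjective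
  refine ⟨s, hs, hs', fun M _ _ f x => ?_⟩
  -- Although `s` is only `C`-linear, `f ∘ s` is `B`-linear, because `E` acts as zero on source and
  -- target.
  let g : ViaB k C P →ₗ[(RelationExtension k C)ᵐᵒᵖ] ViaB k C M :=
    { toFun := fun p => f (s p)
      map_add' := fun p p' => by
        rw [← map_add]; exact congrArg f (map_add s p p')
      map_smul' := fun b p => (congrArg f (hs _ p)).trans (map_smul f _ _) }
  -- The two maps agree on the image of `s`, which together with `ker d₀` spans `P₀`.
  have hG : LinearMap.eqLocus f (g ∘ₗ d₀) = ⊤ := h.superfluous _ <| by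
    rw [Submodule.eq_top_iff']
    intro y
    rw [Submodule.mem_sup]
    refine ⟨s (d₀ y), ?_, y - s (d₀ y), ?_, add_sub_cancel _ _⟩
    · exact (congrArg (fun p => f (s p)) (hs' (d₀ y))).symm
    · rw [LinearMap.mem_ker, map_sub, sub_eq_zero]
      exact (hs' (d₀ y)).symm
  exact (hG ▸ Submodule.mem_top : x ∈ LinearMap.eqLocus f (g ∘ₗ d₀))

theorem apply_eq_zero_of_mem_ker (h : IsProjectiveCover (RelationExtension k C)ᵐᵒᵖ d₀)
    (f : P₀ →ₗ[(RelationExtension k C)ᵐᵒᵖ] ViaB k C M) {x : P₀} (hx : d₀ x = 0) : f x = 0 := by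
  obtain ⟨s, -, -, hs⟩ := exists_section_of_isProjectiveCover h
  rw [hs M f x, hx]
  exact (congrArg f (map_zero s)).trans (map_zero f)

/-- The kernel of the projective cover of a projective right `C`-module `P` over the relation
extension is `Ext²(DC, P)`. -/
theorem exists_ker_equiv_extTwo (h : IsProjectiveCover (RelationExtension k C)ᵐᵒᵖ d₀) :
    ∃ e : LinearMap.ker d₀ ≃+ ExtTwo k C P, ∀ (b : RelationExtension k C) (x : LinearMap.ker d₀),
      e (op b • x) = (Abelian.Ext.mk₀ (dualLeftMul k b.fst)).comp (e x) (zero_add 2) := by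
  obtain ⟨s, hs, hds, hf⟩ := exists_section_of_isProjectiveCover h
  have := h.finite
  have := h.projective
  obtain ⟨n, x, g, hg⟩ := exists_dual_basis (Λ := RelationExtension k C) P₀
  -- The `B`-dual basis `(x j, g j)` of `P₀` descends to a `C`-dual basis of `P`: the elements `d₀
  -- (x j)`, encoded as maps `o j : C → P`, and the coordinates `γ j`.
  let o : Fin n → (ModuleCat.of Cᵐᵒᵖ C ⟶ ModuleCat.of Cᵐᵒᵖ P) := fun j =>
    ModuleCat.ofHom (orbitMap (show P from d₀ (x j)))
  let γ' : Fin n → P →ₗ[Cᵐᵒᵖ] C := fun j =>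
    { toFun := fun p => (g j (s p)).fst
      map_add' := fun p p' => by rw [map_add, map_add, TrivSqZeroExt.fst_add]
      map_smul' := fun c p => by
        obtain ⟨c, rfl⟩ := op_surjective c
        rw [hs, map_smul]; rfl }
  let γ : Fin n → (ModuleCat.of Cᵐᵒᵖ P ⟶ ModuleCat.of Cᵐᵒᵖ C) := fun j => ModuleCat.ofHom (γ' j)
  have hγ : ∀ j y, (g j y).fst = γ' j (d₀ y) := fun j y => hf C (fstViaB ∘ₗ g j) y
  have hγo : ∑ j, γ j ≫ o j = 𝟙 _ := by
    refine ModuleCat.hom_ext (LinearMap.ext fun p => ?_)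
    rw [ModuleCat.hom_sum, LinearMap.sum_apply]
    refine Eq.trans ?_ (hds p)
    conv_rhs => rw [← hg (s p), map_sum]
    refine Finset.sum_congr rfl fun j _ => ?_
    rw [map_smul]
    rfl
  have hoγ : ∀ i j, leftMul (g i (x j)).fst = o j ≫ γ i := fun i j => by
    rw [hγ]
    exact ModuleCat.hom_ext (LinearMap.ext fun y => (map_smul (γ' i) (op y) _).symm)
  have hfst : ∀ j y, d₀ y = 0 → (g j y).fst = 0 := fun j y hy => by
    rw [hγ, hy]; exact map_zero (γ' j)
  let ε : Fin n → P₀ →+ ExtDual k C := fun j =>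
    { toFun := fun y => (g j y).snd
      map_zero' := by rw [map_zero]; rfl
      map_add' := fun y y' => by rw [map_add]; rfl }
  -- On `ker d₀` the coordinates `g j y` lie in `E`; pushing each along `o j` and summing plays the
  -- role of `P ⊗ E ≅ Ext²(DC, P)`.
  let Φ : LinearMap.ker d₀ →+ ExtTwo k C P := AddMonoidHom.mk'
    (fun y => ∑ j, (ε j y).comp (Abelian.Ext.mk₀ (o j)) (add_zero 2)) (fun y y' => by
      rw [← Finset.sum_add_distrib]
      refine Finset.sum_congr rfl fun j _ => ?_
      rw [← Abelian.Ext.add_comp, ← map_add]; rfl)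
  have hε : ∀ i j (b : RelationExtension k C), b.fst = 0 → ε i (op b • x j) =
      (Abelian.Ext.comp (show ExtDual k C from b.snd) (Abelian.Ext.mk₀ (o j))
        (add_zero 2)).comp (Abelian.Ext.mk₀ (γ i)) (add_zero 2) := fun i j b hb => by
    rw [Abelian.Ext.comp_assoc_of_third_deg_zero, Abelian.Ext.mk₀_comp_mk₀, ← hoγ]
    change (g i (op b • x j)).snd = _
    rw [map_smul]
    change ((g i (x j)).fst • b.snd + op b.fst • (g i (x j)).snd : RelationBimodule k C) = _
    rw [hb, MulOpposite.op_zero, zero_smul, add_zero]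
    rfl
  have hsum : ∀ i (b : Fin n → RelationExtension k C), (∀ j, (b j).fst = 0) →
      ε i (∑ j, op (b j) • x j) =
        (∑ j, Abelian.Ext.comp (show ExtDual k C from (b j).snd) (Abelian.Ext.mk₀ (o j))
          (add_zero 2)).comp (Abelian.Ext.mk₀ (γ i)) (add_zero 2) := fun i b hb => by
    rw [map_sum]
    refine (Finset.sum_congr rfl fun j _ => hε i j (b j) (hb j)).trans ?_
    exact (map_sum ((Abelian.Ext.mk₀ (γ i)).postcomp _ (add_zero 2)) _ _).symm
  have hη : ∀ η : ExtTwo k C P, ∑ j, (η.comp (Abelian.Ext.mk₀ (γ j)) (add_zero 2)).comp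
      (Abelian.Ext.mk₀ (o j)) (add_zero 2) = η := fun η => by
    conv_rhs => rw [← Abelian.Ext.comp_mk₀_id η, ← hγo]
    rw [← Abelian.Ext.addEquiv₀_symm_apply, map_sum]
    refine Eq.trans ?_ (map_sum (Abelian.Ext.bilinearComp _ _ _ 2 0 2 (add_zero 2) η) _ _).symm
    refine Finset.sum_congr rfl fun j _ => ?_
    rw [Abelian.Ext.comp_assoc_of_third_deg_zero, Abelian.Ext.mk₀_comp_mk₀]
    rfl
  refine ⟨AddEquiv.ofBijective Φ ⟨?_, ?_⟩, ?_⟩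
  · rw [injective_iff_map_eq_zero]
    rintro ⟨y, hy⟩ h0
    -- By `hsum`, the `i`-th coordinate of `y` is `Φ y` composed with `γ i`, so `Φ y` determines
    -- `y`.
    have hgy : ∀ i, g i y = 0 := fun i => by
      refine TrivSqZeroExt.ext (hfst i y hy) ?_
      change ε i y = 0
      conv_lhs => rw [← hg y]
      rw [hsum i _ fun j => hfst j y hy]
      change (Φ ⟨y, hy⟩).comp _ _ = 0
      rw [h0, Abelian.Ext.zero_comp]
    refine Subtype.ext ?_
    change y = 0
    rw [← hg y]
    exact Finset.sum_eq_zero fun i _ => by rw [hgy, MulOpposite.op_zero, zero_smul]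
  · intro η
    let b : Fin n → RelationExtension k C := fun j =>
      TrivSqZeroExt.inr (η.comp (Abelian.Ext.mk₀ (γ j)) (add_zero 2) : ExtDual k C)
    have hb : d₀ (∑ j, op (b j) • x j) = 0 := by
      rw [map_sum]
      refine Finset.sum_eq_zero fun j _ => ?_
      rw [map_smul]
      exact zero_smul Cᵐᵒᵖ (show P from d₀ (x j))
    refine ⟨⟨_, hb⟩, ?_⟩
    change ∑ i, (ε i (∑ j, op (b j) • x j)).comp (Abelian.Ext.mk₀ (o i)) (add_zero 2) = η
    conv_rhs => rw [← hη η]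
    refine Finset.sum_congr rfl fun i _ => ?_
    rw [hsum i b fun _ => rfl]
    congr 2
    exact hη η
  · intro b y
    change ∑ j, (ε j (op b • y.1)).comp (Abelian.Ext.mk₀ (o j)) (add_zero 2) =
      Abelian.Ext.precomp (Abelian.Ext.mk₀ (dualLeftMul k b.fst)) _ (zero_add 2)
        (∑ j, (ε j y).comp (Abelian.Ext.mk₀ (o j)) (add_zero 2))
    rw [map_sum]
    refine Finset.sum_congr rfl fun j _ => ?_
    have hj : ε j (op b • y.1) =
        (Abelian.Ext.mk₀ (dualLeftMul k b.fst)).comp (ε j y) (zero_add 2) := by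
      change (g j (op b • y.1)).snd = _
      rw [map_smul]
      change ((g j y).fst • b.snd + op b.fst • (g j y).snd : RelationBimodule k C) = _
      rw [hfst j y y.2, zero_smul, zero_add]
      rfl
    rw [hj]
    exact Abelian.Ext.comp_assoc_of_third_deg_zero _ _ _ _

end Extension

/-! ### Comparison of projective covers and the characterization of rigidity -/

section Comparison

variable {k C : Type u} [Field k] [Ring C] [Algebra k C]

theorem IsProjectiveCover.comp_equiv {R : Type u} [Ring R] {P M N : Type u} [AddCommGroup P]
    [Module R P] [AddCommGroup M] [Module R M] [AddCommGroup N] [Module R N] {π : P →ₗ[R] M}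
    (h : IsProjectiveCover R π) (e : M ≃ₗ[R] N) : IsProjectiveCover R (e.toLinearMap ∘ₗ π) where
  finite := h.finite
  projective := h.projective
  surjective := e.surjective.comp h.surjective
  superfluous := by
    rw [LinearEquiv.ker_comp]
    exact h.superfluous

/-- A right `C`-module has the same maps to right `C`-modules from its projective covers over `C`
and over the relation extension, as far as vanishing is concerned. -/
theorem hom_viaB_eq_zero_iff {X P Q P₁ : Type u} [AddCommGroup X] [Module Cᵐᵒᵖ X]
    [AddCommGroup P] [Module Cᵐᵒᵖ P] [AddCommGroup Q] [Module Cᵐᵒᵖ Q] [AddCommGroup P₁]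
    [Module (RelationExtension k C)ᵐᵒᵖ P₁] {π : Q →ₗ[Cᵐᵒᵖ] X}
    {q : P₁ →ₗ[(RelationExtension k C)ᵐᵒᵖ] ViaB k C X} (hπ : IsProjectiveCover Cᵐᵒᵖ π)
    (hq : IsProjectiveCover (RelationExtension k C)ᵐᵒᵖ q) :
    (∀ f : P₁ →ₗ[(RelationExtension k C)ᵐᵒᵖ] ViaB k C P, f = 0) ↔
      ∀ f : Q →ₗ[Cᵐᵒᵖ] P, f = 0 := by
  have := hπ.projective
  have := hq.projective
  constructor
  · intro H f
    -- The lift `h : P₁ → Q` of `q` is onto since `ker π` is superfluous, so `f ∘ h = 0` gives `f =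
    -- 0`.
    obtain ⟨h, hh⟩ := Module.projective_lifting_property (viaBMap (k := k) π) q hπ.surjective
    let N : Submodule Cᵐᵒᵖ Q :=
      { carrier := {y | ∃ x, h x = y}
        zero_mem' := ⟨0, map_zero h⟩
        add_mem' := by
          rintro _ _ ⟨x, rfl⟩ ⟨y, rfl⟩
          exact ⟨x + y, map_add h x y⟩
        smul_mem' := by
          rintro c _ ⟨x, rfl⟩
          exact ⟨op (TrivSqZeroExt.inl (unop c)) • x, map_smul h _ x⟩ }
    have hN : N = ⊤ := hπ.superfluous N <| by
      rw [Submodule.eq_top_iff']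
      intro y
      obtain ⟨x, hx⟩ := hq.surjective (π y)
      rw [Submodule.mem_sup]
      refine ⟨h x, ⟨x, rfl⟩, y - (show Q from h x), ?_, add_sub_cancel _ _⟩
      rw [LinearMap.mem_ker, map_sub, sub_eq_zero, ← hx, ← hh]
      rfl
    ext y
    obtain ⟨x, rfl⟩ : y ∈ N := hN ▸ Submodule.mem_top
    exact LinearMap.congr_fun (H (viaBMap f ∘ₗ h)) x
  · intro H f
    -- Conversely `f ∘ s : Q → P` is `C`-linear, hence zero. So `ker f` contains the image of `s`,
    -- which together with the superfluous `ker q` spans `P₁`.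
    obtain ⟨s, hs, hqs⟩ := exists_lift_via_inl π q hq.surjective
    let g : Q →ₗ[Cᵐᵒᵖ] P :=
      { toFun := fun y => f (s y)
        map_add' := fun y y' => by rw [map_add]; exact map_add f _ _
        map_smul' := fun c y => (congrArg f (hs (unop c) y)).trans (map_smul f _ _) }
    have hker : LinearMap.ker f = ⊤ := hq.superfluous _ <| by
      rw [Submodule.eq_top_iff']
      intro x
      obtain ⟨y, hy⟩ := hπ.surjective (q x)
      rw [Submodule.mem_sup]
      refine ⟨s y, LinearMap.congr_fun (H g) y, x - s y, ?_, add_sub_cancel _ _⟩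
      rw [LinearMap.mem_ker, map_sub, sub_eq_zero, ← hy, hqs]
    exact LinearMap.ker_eq_top.1 hker

variable [FiniteDimensional k C]

/-- The kernel of the projective cover of a projective right `C`-module `P` over the relation
extension is `τ⁻¹ Ω⁻¹ P`. -/
theorem exists_ker_equiv_viaB (hC : GlobalDimensionLE C 2) {P W X P₀ : Type u} [AddCommGroup P]
    [Module Cᵐᵒᵖ P] [Module.Projective Cᵐᵒᵖ P] [AddCommGroup W] [Module k W] [Module Cᵐᵒᵖ W]
    [IsScalarTower k Cᵐᵒᵖ W] (hW : IsCosyzygy C P W) [AddCommGroup X] [Module Cᵐᵒᵖ X]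
    (hX : IsTauInv k C W X) [AddCommGroup P₀] [Module (RelationExtension k C)ᵐᵒᵖ P₀]
    {d₀ : P₀ →ₗ[(RelationExtension k C)ᵐᵒᵖ] ViaB k C P}
    (h : IsProjectiveCover (RelationExtension k C)ᵐᵒᵖ d₀) :
    Nonempty (LinearMap.ker d₀ ≃ₗ[(RelationExtension k C)ᵐᵒᵖ] ViaB k C X) := by
  obtain ⟨I, _, _, i, hi, ⟨w⟩⟩ := hW
  obtain ⟨Q₁, Q₀, _, _, _, _, δ₁, δ₀, hδ, ⟨t⟩⟩ := hX
  have := hi.finite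
  have := hi.isInjective
  let p : I →ₗ[Cᵐᵒᵖ] W := w.symm.toLinearMap ∘ₗ (LinearMap.range i).mkQ
  have hp : Function.Surjective p := w.symm.surjective.comp (Submodule.mkQ_surjective _)
  have hip : LinearMap.range i = LinearMap.ker p := by
    rw [LinearEquiv.ker_comp, Submodule.ker_mkQ]
  have : Module.Finite k Cᵐᵒᵖ := Module.Finite.equiv (opLinearEquiv k)
  have : Module.Finite Cᵐᵒᵖ W := Module.Finite.of_surjective p hp
  have : Module.Finite k W := Module.Finite.trans Cᵐᵒᵖ W
  let : Module k Q₁ := Module.compHom Q₁ (algebraMap k C)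
  have : IsScalarTower k C Q₁ := IsScalarTower.of_algebraMap_smul fun _ _ => rfl
  let : Module k Q₀ := Module.compHom Q₀ (algebraMap k C)
  have : IsScalarTower k C Q₀ := IsScalarTower.of_algebraMap_smul fun _ _ => rfl
  obtain ⟨e₁, he₁⟩ := exists_trLeft_equiv_extTwo (k := k) hC hi.injective hp hip hδ
  obtain ⟨e₂, he₂⟩ := exists_ker_equiv_extTwo h
  -- Both isomorphisms carry the right action to precomposition with the left action on `DC`, so the
  -- composite is `B`-linear.
  refine ⟨{ (e₂.trans e₁.symm).trans t.symm.toAddEquiv with map_smul' := fun b x => ?_ }⟩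
  change t.symm (e₁.symm (e₂ (b • x))) = op (unop b).fst • t.symm (e₁.symm (e₂ x))
  rw [← map_smul]
  congr 1
  rw [AddEquiv.symm_apply_eq, he₁, AddEquiv.apply_symm_apply]
  exact he₂ (unop b) x

theorem isTauRigid_viaB_iff (hC : GlobalDimensionLE C 2) {P W X Q : Type u} [AddCommGroup P]
    [Module Cᵐᵒᵖ P] [Module.Finite Cᵐᵒᵖ P] [Module.Projective Cᵐᵒᵖ P] [AddCommGroup W] [Module k W]
    [Module Cᵐᵒᵖ W] [IsScalarTower k Cᵐᵒᵖ W] (hW : IsCosyzygy C P W) [AddCommGroup X]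
    [Module Cᵐᵒᵖ X] (hX : IsTauInv k C W X) [AddCommGroup Q] [Module Cᵐᵒᵖ Q] {π : Q →ₗ[Cᵐᵒᵖ] X}
    (hπ : IsProjectiveCover Cᵐᵒᵖ π) :
    IsTauRigid k (RelationExtension k C) (ViaB k C P) ↔ ∀ f : Q →ₗ[Cᵐᵒᵖ] P, f = 0 := by
  -- Rigidity is stated through some minimal presentation. Proving the equivalence for all of them
  -- serves both directions, the converse also needing that one exists.
  have key : ∀ (P₁ P₀ : Type u) [AddCommGroup P₁] [Module (RelationExtension k C)ᵐᵒᵖ P₁]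
      [AddCommGroup P₀] [Module (RelationExtension k C)ᵐᵒᵖ P₀]
      (d₁ : P₁ →ₗ[(RelationExtension k C)ᵐᵒᵖ] P₀)
      (d₀ : P₀ →ₗ[(RelationExtension k C)ᵐᵒᵖ] ViaB k C P),
      IsMinimalProjectivePresentation (RelationExtension k C)ᵐᵒᵖ d₁ d₀ →
      ((∀ F : ViaB k C P →ₗ[(RelationExtension k C)ᵐᵒᵖ]
        StdDual k (TrRight (RelationExtension k C) d₁), F = 0) ↔
          ∀ f : Q →ₗ[Cᵐᵒᵖ] P, f = 0) := by
    intro P₁ P₀ _ _ _ _ d₁ d₀ h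
    have := h.cover₀.finite
    have := h.cover₀.projective
    have := h.cover₁.finite
    have := h.cover₁.projective
    obtain ⟨e⟩ := exists_ker_equiv_viaB hC hW hX h.cover₀
    rw [hom_stdDual_trRight_eq_zero_iff, ← hom_viaB_eq_zero_iff hπ
      (h.cover₁.comp_equiv ((LinearEquiv.ofEq _ _ h.exact).trans e))]
    -- A map `g ∘ d₁` is zero because `g` kills `ker d₀`, so factoring through `d₁` amounts to
    -- vanishing.
    refine forall_congr' fun f => ⟨?_, fun hf => ⟨0, by rw [hf, LinearMap.zero_comp]⟩⟩
    rintro ⟨g, rfl⟩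
    ext x
    exact apply_eq_zero_of_mem_ker h.cover₀ g (h.exact.le (LinearMap.mem_range_self d₁ x))
  constructor
  · rintro ⟨N, _, _, ⟨P₁, P₀, _, _, _, _, d₁, d₀, h, ⟨e⟩⟩, hN⟩
    refine (key P₁ P₀ d₁ d₀ h).1 fun F => ?_
    have := hN (e.symm.toLinearMap ∘ₗ F)
    ext x : 1
    exact e.symm.injective ((LinearMap.congr_fun this x).trans (map_zero e.symm).symm)
  · intro H
    have : Module.Finite (RelationExtension k C)ᵐᵒᵖ (ViaB k C P) := by
      obtain ⟨S, hS⟩ := Module.Finite.fg_top (R := Cᵐᵒᵖ) (M := P)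
      let T : Submodule (RelationExtension k C)ᵐᵒᵖ (ViaB k C P) := Submodule.span _ {x | x ∈ S}
      let N : Submodule Cᵐᵒᵖ P :=
        { carrier := {x | (show ViaB k C P from x) ∈ T}
          zero_mem' := T.zero_mem
          add_mem' := T.add_mem
          smul_mem' := fun c _ hx => T.smul_mem (op (TrivSqZeroExt.inl (unop c))) hx }
      have hSN : Submodule.span Cᵐᵒᵖ (S : Set P) ≤ N :=
        Submodule.span_le.2 fun x hx => Submodule.subset_span (M := ViaB k C P) hx
      rw [hS] at hSN
      exact ⟨Submodule.fg_def.2 ⟨_, S.finite_toSet, Submodule.eq_top_iff'.2 fun x =>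
        hSN (Submodule.mem_top : (show P from x) ∈ _)⟩⟩
    obtain ⟨P₁, P₀, _, _, _, _, d₁, d₀, h⟩ :=
      exists_isMinimalProjectivePresentation (R := (RelationExtension k C)ᵐᵒᵖ) (ViaB k C P)
    exact ⟨_, _, _, ⟨P₁, P₀, _, _, _, _, d₁, d₀, h, ⟨LinearEquiv.refl _ _⟩⟩,
      (key P₁ P₀ d₁ d₀ h).2 H⟩

end Comparison

end TauRigid

theorem proposition4p1
    (k : Type u) [Field k] [IsAlgClosed k]
    (C : Type u) [Ring C] [Algebra k C] [FiniteDimensional k C]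
    (hC : TauRigid.GlobalDimensionLE C 2)
    -- `P` is a finitely generated projective right `C`-module
    (P : Type u) [AddCommGroup P] [Module Cᵐᵒᵖ P]
    [Module.Finite Cᵐᵒᵖ P] [Module.Projective Cᵐᵒᵖ P]
    -- `W = Ω⁻¹ P`
    (W : Type u) [AddCommGroup W] [Module k W] [Module Cᵐᵒᵖ W] [IsScalarTower k Cᵐᵒᵖ W]
    (hW : TauRigid.IsCosyzygy C P W)
    -- `X = τ⁻¹ Ω⁻¹ P`
    (X : Type u) [AddCommGroup X] [Module Cᵐᵒᵖ X]
    (hX : TauRigid.IsTauInv k C W X)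
    -- `π : Pbar → X` is a projective cover
    (Pbar : Type u) [AddCommGroup Pbar] [Module Cᵐᵒᵖ Pbar]
    (π : Pbar →ₗ[Cᵐᵒᵖ] X) (hπ : TauRigid.IsProjectiveCover Cᵐᵒᵖ π) :
    TauRigid.IsTauRigid k (TauRigid.RelationExtension k C) (TauRigid.ViaB k C P) ↔
      ∀ f : Pbar →ₗ[Cᵐᵒᵖ] P, f = 0 :=
  TauRigid.isTauRigid_viaB_iff hC hW hX hπ
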